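/- Let $B^1,B^2$ be independent one-dimensional standard Brownian motions and let $\eta:[0,\infty)^2\to[0,\infty)$ be a measurable function satisfying condition C1): for all $T>0$, $$\|\eta\|_{1,T}:=\max\Big(\sup_{0\le t\le T}\int_0^T\eta(s,t)\,ds,\ \sup_{0\le s\le T}\int_0^T\eta(s,t)\,dt\Big)<\infty .$$ Fix $T>0$, let $p_\varepsilon(x)=(2\pi\varepsilon)^{-1/2}e^{-|x|^2/(2\varepsilon)}$, and for $\varepsilon>0$ put $$I_\varepsilon=\int_0^T\!\int_0^T\eta(s,t)\,p_\varepsilon(B^1_s-B^2_t)\,ds\,dt .$$ Then for every $\lambda>0$ $$\sup_{\varepsilon>0}E\big(\exp(\lambda I_\varepsilon)\big)\le 1+\Phi\Big(\frac{\sqrt T}{2}\,\|\eta\|_{1,T}\,\lambda\Big),\qquad \Phi(x)=\sum_{k=1}^\infty\frac{x^k}{\Gamma\left(\frac k2+1\right)} .$$ Moreover, there is a random variable $I$ (the weighted intersection local time) such that $I_\varepsilon\to I$ in $L^p$ as $\varepsilon\downarrow0$ for every $p\in[1,\infty)$, and $E(\exp(\lambda I))\le 1+\Phi\big(\frac{\sqrt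 T}{2}\|\eta\|_{1,T}\lambda\big)$ for every $\lambda>0$. -/

import Mathlib

open MeasureTheory ProbabilityTheory Filter Topology
open scoped NNReal ENNReal

noncomputable section

namespace WeightedIntersection

/-- The one-dimensional heat kernel `p_t(x) = (2πt)^{-1/2} exp(-|x|²/(2t))`. -/
def heatKernel (t x : ℝ) : ℝ :=
  (2 * Real.pi * t) ^ (-(1 / 2 : ℝ)) * Real.exp (-|x| ^ 2 / (2 * t))

/-- `η` is a weight: a nonnegative measurable function on `[0,∞) × [0,∞)`.
(Its values off this quadrant are irrelevant everywhere below.) -/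
structure IsWeight (η : ℝ → ℝ → ℝ) : Prop where
  nonneg : ∀ s t : ℝ, 0 ≤ s → 0 ≤ t → 0 ≤ η s t
  measurable : Measurable
    ((Set.Ici (0 : ℝ) ×ˢ Set.Ici (0 : ℝ)).domRestrict (fun q : ℝ × ℝ => η q.1 q.2))

/-- The norm `‖η‖_{1,T}`, the larger of `sup_{0≤t≤T} ∫₀ᵀ η(s,t) ds` and
`sup_{0≤s≤T} ∫₀ᵀ η(s,t) dt`, as an element of `[0,∞]`. -/
def weightENorm (η : ℝ → ℝ → ℝ) (T : ℝ) : ℝ≥0∞ :=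
  max (⨆ t ∈ Set.Icc (0 : ℝ) T, ∫⁻ s in Set.Icc (0 : ℝ) T, ENNReal.ofReal (η s t))
    (⨆ s ∈ Set.Icc (0 : ℝ) T, ∫⁻ t in Set.Icc (0 : ℝ) T, ENNReal.ofReal (η s t))

/-- The norm `‖η‖_{1,T}` as a real number, meaningful when it is finite. -/
def weightNorm (η : ℝ → ℝ → ℝ) (T : ℝ) : ℝ := (weightENorm η T).toReal

/-- The condition C1: `‖η‖_{1,T} < ∞` for all `T > 0`. -/
def ConditionC1 (η : ℝ → ℝ → ℝ) : Prop := ∀ T : ℝ, 0 < T → weightENorm η T < ⊤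

/-- The approximate weighted intersection local time
`I_ε = ∫₀ᵀ ∫₀ᵀ η(s,t) p_ε(B¹_s - B²_t) ds dt`. -/
def approxLocalTime {Ω : Type*} (B₁ B₂ : ℝ≥0 → Ω → ℝ) (η : ℝ → ℝ → ℝ) (T ε : ℝ) (ω : Ω) : ℝ :=
  ∫ t in Set.Icc (0 : ℝ) T, ∫ s in Set.Icc (0 : ℝ) T,
    η s t * heatKernel ε (B₁ s.toNNReal ω - B₂ t.toNNReal ω)

/-- The entire function `Φ(x) = ∑_{k ≥ 1} x^k / Γ(k/2 + 1)`; the index below is `k - 1`. -/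
def Phi (x : ℝ) : ℝ := ∑' j : ℕ, x ^ (j + 1) / Real.Gamma (((j + 1 : ℕ) : ℝ) / 2 + 1)

end WeightedIntersection

end

/-!
The moments of the approximate local times `I_ε` are computed by Tonelli's theorem
(`lintegral_prod_mollifiedTime`): `E I_ε ^ n` is the integral over `n` pairs of times `(sᵢ, tᵢ)` of
`∏ η(sᵢ, tᵢ)` times the mollified probability `E ∏ p_ε(B¹_{sᵢ} - B²_{tᵢ})` that the motions
coincide at these times.

If `(B¹_{sᵢ})` and `(B²_{tᵢ})` have densities `g` and `h`, this probability is
`∫∫ g(x) h(y) ∏ p_ε(xᵢ - yᵢ) dx dy`. Since `g h ≤ (g² + h²) / 2` and the heat kernel integrates to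
`1`, it is at most `(∫ g² + ∫ h²) / 2` (`lintegral_mollifier_sub_le`). For increasing times, `g` is
a product of Gaussian densities of the increments (`hasSquareDensity_of_monotone`), so `∫ g²` is the
product of the `(4π(sᵢ - sᵢ₋₁))^{-1/2}` (`chainWeight`). As each of the two terms depends on the
`sᵢ` alone or on the `tᵢ` alone, integrating `∏ η(sᵢ, tᵢ)` over the other variables costs only `‖η‖ ^ n`, and the
remaining integral is `n!` times a Beta integral over a simplex (`lintegral_chainWeight_le`). The
outcome is `E I_ε ^ n ≤ n! (√T ‖η‖ / 2) ^ n / Γ(n/2 + 1)`, and summing the exponential series gives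
the bound on the exponential moments.

For the limit, `E ∏ p_{εᵢ}(B¹_{sᵢ} - B²_{tᵢ})` converges as the `εᵢ` tend to `0`, because `g` is
continuous and bounded (`exists_tendsto_lintegral_mollifier_sub`). By dominated convergence
`E (I_ε I_δ)` converges as `ε, δ → 0`, so that `I_ε` is Cauchy in `L²`. The uniform moment bounds
improve this to convergence in every `Lᵖ` (`exists_tendsto_eLpNorm`), and Fatou's lemma transfers
the exponential bound to the limit.
-/

namespace WeightedIntersection

/-! ### Tonelli's theorem on finite powers -/

theorem lintegral_pi_succ {α : Type*} [MeasurableSpace α] {n : ℕ} (μ : Fin (n + 1) → Measure α)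
    [∀ i, SigmaFinite (μ i)] {f : (Fin (n + 1) → α) → ℝ≥0∞} (hf : Measurable f) :
    ∫⁻ x, f x ∂Measure.pi μ
      = ∫⁻ a, ∫⁻ y, f (Fin.cons a y) ∂Measure.pi (fun i : Fin n => μ i.succ) ∂μ 0 := by
  have h := (measurePreserving_piFinSuccAbove μ 0).symm
  rw [← h.lintegral_comp hf, lintegral_prod]
  · simp [MeasurableEquiv.piFinSuccAbove, Fin.insertNthEquiv]
  · exact (hf.comp h.measurable).aemeasurable

theorem lintegral_pi_prod {α : Type*} [MeasurableSpace α] {n : ℕ} (μ : Fin n → Measure α)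
    [∀ i, SigmaFinite (μ i)] {f : Fin n → α → ℝ≥0∞} (hf : ∀ i, Measurable (f i)) :
    ∫⁻ x, ∏ i, f i (x i) ∂Measure.pi μ = ∏ i, ∫⁻ a, f i a ∂μ i := by
  induction n with
  | zero => simp
  | succ n ih =>
    rw [lintegral_pi_succ]
    · simp only [Fin.prod_univ_succ, Fin.cons_zero, Fin.cons_succ]
      have : ∀ a, ∫⁻ y : Fin n → α, f 0 a * ∏ i : Fin n, f i.succ (y i)
          ∂Measure.pi (fun i : Fin n => μ i.succ)
          = f 0 a * ∏ i : Fin n, ∫⁻ b, f i.succ b ∂μ i.succ := by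
        intro a
        rw [lintegral_const_mul, ih (fun i => μ i.succ) (fun i => hf i.succ)]
        exact Finset.measurable_prod _ fun i _ => (hf _).comp (measurable_pi_apply i)
      simp_rw [this]
      rw [lintegral_mul_const _ (hf 0)]
    · exact Finset.measurable_prod _ fun i _ => (hf _).comp (measurable_pi_apply i)

theorem pi_withDensity {α : Type*} [MeasurableSpace α] {n : ℕ} (μ : Measure α) [SigmaFinite μ]
    {f : Fin n → α → ℝ≥0∞} (hf : ∀ i, Measurable (f i))
    [∀ i, SigmaFinite (μ.withDensity (f i))] :
    Measure.pi (fun i => μ.withDensity (f i))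
      = (Measure.pi fun _ : Fin n => μ).withDensity (fun x => ∏ i, f i (x i)) := by
  refine Measure.pi_eq fun s hs => ?_
  rw [withDensity_apply _ (MeasurableSet.univ_pi hs),
    ← lintegral_indicator (MeasurableSet.univ_pi hs)]
  have : ∀ x : Fin n → α, (Set.univ.pi s).indicator (fun x => ∏ i, f i (x i)) x
      = ∏ i, (s i).indicator (f i) (x i) := by
    intro x
    by_cases hx : ∀ i, x i ∈ s i
    · rw [Set.indicator_of_mem (by simpa [Set.mem_pi] using hx)]
      exact Finset.prod_congr rfl fun i _ => (Set.indicator_of_mem (hx i) _).symm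
    · rw [Set.indicator_of_notMem (by simpa [Set.mem_pi] using hx)]
      push Not at hx
      obtain ⟨i, hi⟩ := hx
      exact (Finset.prod_eq_zero (Finset.mem_univ i) (Set.indicator_of_notMem hi _)).symm
  simp_rw [this]
  rw [lintegral_pi_prod (fun _ => μ) (fun i => (hf i).indicator (hs i))]
  exact Finset.prod_congr rfl fun i _ => by
    rw [lintegral_indicator (hs i), withDensity_apply _ (hs i)]

theorem lintegral_pi_comp_perm {α : Type*} [MeasurableSpace α] {n : ℕ} (μ : Measure α)
    [SigmaFinite μ] (σ : Equiv.Perm (Fin n)) {f : (Fin n → α) → ℝ≥0∞} (hf : Measurable f) :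
    ∫⁻ x, f (x ∘ σ) ∂Measure.pi (fun _ : Fin n => μ)
      = ∫⁻ x, f x ∂Measure.pi (fun _ : Fin n => μ) := by
  have h := measurePreserving_piCongrLeft (α := fun _ : Fin n => α) (fun _ => μ) σ.symm
  rw [← h.lintegral_comp hf]
  congr 1 with x
  congr 1 with i
  have := Equiv.piCongrLeft_apply_apply (fun _ : Fin n => α) σ.symm x (σ i)
  simp only [Equiv.symm_apply_apply] at this
  simpa [MeasurableEquiv.coe_piCongrLeft] using this.symm

/-! ### The simplex integral -/

/-- The weight `(4πx)^{-1/2}` of a gap `x ≥ 0` between consecutive times, which is the squared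
`L²` norm of the Gaussian density of variance `x`. It is `∞` at `0` and `0` on negative numbers. -/
noncomputable def gapWeight (x : ℝ) : ℝ≥0∞ :=
  if x < 0 then 0 else (ENNReal.ofReal (4 * Real.pi * x)) ^ (-(1 / 2) : ℝ)

@[fun_prop]
theorem measurable_gapWeight : Measurable gapWeight := by
  unfold gapWeight
  exact Measurable.ite measurableSet_Iio measurable_const (by fun_prop)

theorem gapWeight_zero : gapWeight 0 = ∞ := by
  simp [gapWeight, ENNReal.zero_rpow_of_neg]

theorem gapWeight_of_neg {x : ℝ} (hx : x < 0) : gapWeight x = 0 := by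
  simp [gapWeight, hx]

theorem gapWeight_of_pos {x : ℝ} (hx : 0 < x) :
    gapWeight x = ENNReal.ofReal ((4 * Real.pi * x) ^ (-(1 / 2) : ℝ)) := by
  rw [gapWeight, if_neg hx.not_gt, ENNReal.ofReal_rpow_of_pos (by positivity)]

theorem gapWeight_pos {x : ℝ} (hx : 0 ≤ x) : 0 < gapWeight x := by
  rcases hx.eq_or_lt with rfl | hx
  · simp [gapWeight_zero]
  · rw [gapWeight_of_pos hx]
    exact ENNReal.ofReal_pos.2 (by positivity)

/-- The product of the weights of the gaps of `a, s₀, s₁, …, s_{n-1}`. -/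
noncomputable def chainWeight {n : ℕ} (a : ℝ) (s : Fin n → ℝ) : ℝ≥0∞ :=
  ∏ i : Fin n, gapWeight (s i - Fin.cons (α := fun _ => ℝ) a s i.castSucc)

theorem chainWeight_cons {n : ℕ} (a b : ℝ) (s : Fin n → ℝ) :
    chainWeight a (Fin.cons (α := fun _ => ℝ) b s) = gapWeight (b - a) * chainWeight b s := by
  unfold chainWeight
  rw [Fin.prod_univ_succ]
  rfl

theorem measurable_chainWeight {n : ℕ} :
    Measurable fun p : ℝ × (Fin n → ℝ) => chainWeight p.1 p.2 := by
  unfold chainWeight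
  refine Finset.measurable_prod _ fun i _ => measurable_gapWeight.comp ?_
  refine Measurable.sub (by fun_prop) ?_
  rcases i with ⟨_ | i, hi⟩
  · exact measurable_fst
  · exact (measurable_pi_apply (⟨i, by omega⟩ : Fin n)).comp measurable_snd

/-- The coefficient `2^{-n} / Γ(n/2 + 1)` of the integral of `chainWeight` over a simplex. -/
noncomputable def simplexCoeff (n : ℕ) : ℝ := (1 / 2) ^ n / Real.Gamma ((n : ℝ) / 2 + 1)

theorem simplexCoeff_pos (n : ℕ) : 0 < simplexCoeff n :=
  div_pos (by positivity) (Real.Gamma_pos_of_pos (by positivity))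

theorem lintegral_beta {α β : ℝ} (hα : 0 < α) (hβ : 0 < β) :
    ∫⁻ x in Set.Ioo (0 : ℝ) 1, ENNReal.ofReal (x ^ (α - 1) * (1 - x) ^ (β - 1))
      = ENNReal.ofReal (beta α β) := by
  have h := lintegral_betaPDF_eq_one hα hβ
  have hb := beta_pos hα hβ
  rw [lintegral_betaPDF] at h
  simp_rw [mul_assoc] at h
  simp_rw [ENNReal.ofReal_mul (one_div_pos.2 hb).le] at h
  rw [lintegral_const_mul _ (by fun_prop)] at h
  calc _ = ENNReal.ofReal (beta α β) * (ENNReal.ofReal (1 / beta α β) * _) := by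
        rw [← mul_assoc, ← ENNReal.ofReal_mul hb.le, mul_one_div_cancel hb.ne', ENNReal.ofReal_one,
          one_mul]
    _ = _ := by rw [h, mul_one]

/-- A scaled Beta integral: integrating out one gap raises the exponent by `1/2`. -/
theorem lintegral_gapWeight_mul_rpow {a T b : ℝ} (hab : a < T) (hb : 0 ≤ b) :
    ∫⁻ s in Set.Ioo a T, gapWeight (s - a) * ENNReal.ofReal ((T - s) ^ b)
      = ENNReal.ofReal ((4 * Real.pi) ^ (-(1 / 2) : ℝ) * beta (1 / 2) (b + 1)
          * (T - a) ^ (b + 1 / 2)) := by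
  have hTa : 0 < T - a := sub_pos.2 hab
  have him : (fun x => (T - a) * x + a) '' Set.Ioo 0 1 = Set.Ioo a T := by
    rw [Set.image_affine_Ioo hTa]; simp
  rw [← him, lintegral_image_eq_lintegral_abs_deriv_mul measurableSet_Ioo (f' := fun _ => T - a)]
  · rw [mul_right_comm, mul_comm, ENNReal.ofReal_mul' (by positivity),
      ← lintegral_beta (by norm_num) (by positivity), ← lintegral_mul_const _ (by fun_prop)]
    refine setLIntegral_congr_fun measurableSet_Ioo fun x hx => ?_
    have hx0 : 0 < x := hx.1
    have hx1 : 0 < 1 - x := sub_pos.2 hx.2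
    simp only [add_sub_cancel_right]
    rw [gapWeight_of_pos (by positivity), ← ENNReal.ofReal_mul (by positivity),
      ← ENNReal.ofReal_mul (by positivity), ← ENNReal.ofReal_mul (by positivity)]
    congr 1
    rw [abs_of_pos hTa, show T - ((T - a) * x + a) = (T - a) * (1 - x) by ring,
      Real.mul_rpow hTa.le hx1.le, Real.mul_rpow (by positivity) (by positivity),
      Real.mul_rpow hTa.le hx0.le, Real.rpow_add hTa]
    have h1 : (T - a) * (T - a) ^ (-(1 / 2) : ℝ) = (T - a) ^ (1 / 2 : ℝ) := by
      conv_lhs => rw [← Real.rpow_one (T - a), ← Real.rpow_mul hTa.le, ← Real.rpow_add hTa]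
      norm_num
    rw [show (1 / 2 - 1 : ℝ) = -(1 / 2) by norm_num, ← h1]
    ring
  · intro x _
    have := ((hasDerivAt_id x).const_mul (T - a)).add_const a
    simpa using this.hasDerivWithinAt
  · intro x _ y _ h
    have : (T - a) * x = (T - a) * y := by simpa using h
    exact mul_left_cancel₀ hTa.ne' this

/-- The integral of `chainWeight a` over the simplex `a ≤ s₀ ≤ … ≤ s_{n-1} ≤ T`, by induction on the
first coordinate. -/
theorem lintegral_chainWeight_le (n : ℕ) {a T : ℝ} (ha : 0 ≤ a) (haT : a ≤ T) :
    ∫⁻ s, chainWeight a s ∂Measure.pi (fun _ : Fin n => volume.restrict (Set.Icc 0 T))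
      ≤ ENNReal.ofReal (simplexCoeff n * (T - a) ^ ((n : ℝ) / 2)) := by
  induction n generalizing a with
  | zero => simp [chainWeight, simplexCoeff]
  | succ n ih =>
    have hm : ∀ a, Measurable fun s : Fin (n + 1) → ℝ => chainWeight a s := fun a =>
      measurable_chainWeight.comp (measurable_const.prodMk measurable_id)
    have hm' : ∀ a, Measurable fun s : Fin n → ℝ => chainWeight a s := fun a =>
      measurable_chainWeight.comp (measurable_const.prodMk measurable_id)
    rw [lintegral_pi_succ _ (hm a)]
    simp_rw [chainWeight_cons, lintegral_const_mul _ (hm' _)]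
    have hsub : ∫⁻ b in Set.Icc 0 T, gapWeight (b - a) * ∫⁻ s, chainWeight b s
          ∂Measure.pi (fun _ : Fin n => volume.restrict (Set.Icc 0 T))
        = ∫⁻ b in Set.Ioo a T, gapWeight (b - a) * ∫⁻ s, chainWeight b s
          ∂Measure.pi (fun _ : Fin n => volume.restrict (Set.Icc 0 T)) := by
      rw [setLIntegral_congr (Ioo_ae_eq_Icc (a := a) (b := T)),
        ← lintegral_indicator measurableSet_Icc, ← lintegral_indicator measurableSet_Icc]
      congr 1 with b
      by_cases hb : b < a
      · rw [Set.indicator_of_notMem (s := Set.Icc a T) (by simp [hb]), Set.indicator_apply]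
        simp [gapWeight_of_neg (sub_neg.2 hb)]
      · simp only [Set.indicator_apply, Set.mem_Icc, ha.trans (not_lt.1 hb), not_lt.1 hb]
    rw [hsub]
    rcases haT.eq_or_lt with rfl | haT
    · simp
    calc _ ≤ ∫⁻ b in Set.Ioo a T, ENNReal.ofReal (simplexCoeff n) *
          (gapWeight (b - a) * ENNReal.ofReal ((T - b) ^ ((n : ℝ) / 2))) := by
          refine setLIntegral_mono' measurableSet_Ioo fun b hb => ?_
          have := ih (ha.trans hb.1.le) hb.2.le
          rw [ENNReal.ofReal_mul (simplexCoeff_pos n).le] at this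
          calc _ ≤ gapWeight (b - a) * _ := mul_le_mul_right this _
            _ = _ := by ring
      _ = ENNReal.ofReal (simplexCoeff n) * _ := by
          rw [lintegral_const_mul _ (by fun_prop), lintegral_gapWeight_mul_rpow haT (by positivity)]
      _ = _ := by
          rw [← ENNReal.ofReal_mul (simplexCoeff_pos n).le]
          congr 1
          have hG := Real.Gamma_pos_of_pos (show (0 : ℝ) < (n : ℝ) / 2 + 1 by positivity)
          have hG' := Real.Gamma_pos_of_pos (show (0 : ℝ) < ((n + 1 : ℕ) : ℝ) / 2 + 1 by positivity)
          have he : (1 / 2 : ℝ) + ((n : ℝ) / 2 + 1) = ((n + 1 : ℕ) : ℝ) / 2 + 1 := by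
            push_cast; ring
          have h4 : (4 * Real.pi) ^ (-(1 / 2) : ℝ) * √Real.pi = 1 / 2 := by
            rw [Real.rpow_neg (by positivity), ← Real.sqrt_eq_rpow,
              Real.sqrt_mul (by norm_num), show (4 : ℝ) = 2 ^ 2 by norm_num,
              Real.sqrt_sq (by norm_num)]
            field_simp
          rw [beta, he, Real.Gamma_one_half_eq, simplexCoeff, simplexCoeff,
            show (n : ℝ) / 2 + 1 / 2 = ((n + 1 : ℕ) : ℝ) / 2 by push_cast; ring, pow_succ]
          calc _ = ((4 * Real.pi) ^ (-(1 / 2) : ℝ) * √Real.pi) * ((1 / 2) ^ n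
                / Real.Gamma (((n + 1 : ℕ) : ℝ) / 2 + 1)
                * (T - a) ^ (((n + 1 : ℕ) : ℝ) / 2)) := by field_simp
            _ = _ := by rw [h4]; ring

/-- The symmetrization of `chainWeight 0`. Since `chainWeight 0` vanishes on vectors that are not
sorted, for distinct positive times only the sorting permutation contributes. For nonnegative times
the value is `∞` as soon as two of them agree or one of them is `0`. -/
noncomputable def symWeight {n : ℕ} (s : Fin n → ℝ) : ℝ≥0∞ :=
  ∑ σ : Equiv.Perm (Fin n), chainWeight 0 (s ∘ σ)

theorem measurable_symWeight {n : ℕ} : Measurable (symWeight (n := n)) := by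
  refine Finset.measurable_sum _ fun σ _ => ?_
  refine measurable_chainWeight.comp (measurable_const.prodMk ?_)
  exact measurable_pi_lambda _ fun i => measurable_pi_apply _

/-- The factor `n!` is the number of orderings of the times. -/
theorem lintegral_symWeight_le (n : ℕ) {T : ℝ} (hT : 0 ≤ T) :
    ∫⁻ s, symWeight s ∂Measure.pi (fun _ : Fin n => volume.restrict (Set.Icc 0 T))
      ≤ n.factorial * ENNReal.ofReal (simplexCoeff n * T ^ ((n : ℝ) / 2)) := by
  have hm : Measurable fun s : Fin n → ℝ => chainWeight 0 s :=
    measurable_chainWeight.comp (measurable_const.prodMk measurable_id)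
  unfold symWeight
  rw [lintegral_finsetSum]
  · simp_rw [lintegral_pi_comp_perm _ _ hm]
    rw [Finset.sum_const, Finset.card_univ, Fintype.card_perm, Fintype.card_fin, nsmul_eq_mul]
    gcongr
    simpa using lintegral_chainWeight_le n le_rfl hT
  · intro σ _
    exact hm.comp (measurable_pi_lambda _ fun i => measurable_pi_apply _)

/-! ### Densities of the finite-dimensional laws -/

/-- The measure `μ` has a continuous bounded density whose squared `L²` norm is at most `C`. -/
def HasSquareDensity {n : ℕ} (μ : Measure (Fin n → ℝ)) (C : ℝ≥0∞) : Prop :=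
  ∃ g : (Fin n → ℝ) → ℝ, Continuous g ∧ (∀ x, 0 ≤ g x) ∧ (∃ M, ∀ x, g x ≤ M) ∧
    μ = volume.withDensity (fun x => ENNReal.ofReal (g x)) ∧
    ∫⁻ x, ENNReal.ofReal (g x) ^ 2 ≤ C

theorem HasSquareDensity.map {n : ℕ} {μ : Measure (Fin n → ℝ)} {C : ℝ≥0∞}
    (h : HasSquareDensity μ C) (e : (Fin n → ℝ) ≃ₜ (Fin n → ℝ)) (he : MeasurePreserving e) :
    HasSquareDensity (μ.map e) C := by
  obtain ⟨g, hg, hg0, ⟨M, hM⟩, hμ, hC⟩ := h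
  have he' : MeasurePreserving e.symm := MeasurePreserving.symm e.toMeasurableEquiv he
  refine ⟨g ∘ e.symm, hg.comp e.symm.continuous, fun x => hg0 _, ⟨M, fun x => hM _⟩, ?_, ?_⟩
  · ext A hA
    rw [hμ, Measure.map_apply e.measurable hA, withDensity_apply _ (e.measurable hA),
      withDensity_apply _ hA, ← he.setLIntegral_comp_preimage hA (by fun_prop)]
    simp
  · rw [← he.lintegral_comp (by fun_prop)]
    simpa using hC

/-- The square of a Gaussian density of variance `v` is `gapWeight v` times the Gaussian density of
variance `v / 2`. -/
theorem hasSquareDensity_pi_gaussianReal {n : ℕ} {v : Fin n → ℝ≥0} (hv : ∀ i, v i ≠ 0) :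
    HasSquareDensity (Measure.pi fun i => gaussianReal 0 (v i)) (∏ i, gapWeight (v i)) := by
  have hcont : ∀ i, Continuous (gaussianPDFReal 0 (v i)) := fun i => by
    unfold gaussianPDFReal; fun_prop
  refine ⟨fun x => ∏ i, gaussianPDFReal 0 (v i) (x i), ?_, ?_, ⟨∏ i, (√(2 * Real.pi * v i))⁻¹, ?_⟩,
    ?_, ?_⟩
  · exact continuous_finsetProd _ fun i _ => (hcont i).comp (continuous_apply i)
  · exact fun x => Finset.prod_nonneg fun i _ => gaussianPDFReal_nonneg _ _ _
  · refine fun x => Finset.prod_le_prod (fun i _ => gaussianPDFReal_nonneg _ _ _) fun i _ => ?_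
    unfold gaussianPDFReal
    refine mul_le_of_le_one_right (by positivity) (Real.exp_le_one_iff.2 ?_)
    exact div_nonpos_of_nonpos_of_nonneg (neg_nonpos.2 (sq_nonneg _)) (by positivity)
  · have h1 : ∀ i, gaussianReal 0 (v i) = volume.withDensity (gaussianPDF 0 (v i)) := fun i =>
      gaussianReal_of_var_ne_zero 0 (hv i)
    have : ∀ i, SigmaFinite (volume.withDensity (gaussianPDF 0 (v i))) := fun i => by
      rw [← h1]; infer_instance
    simp_rw [h1]
    rw [pi_withDensity _ (fun i => measurable_gaussianPDF 0 (v i)), volume_pi]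
    congr 1 with x
    rw [ENNReal.ofReal_prod_of_nonneg fun i _ => gaussianPDFReal_nonneg _ _ _]
    rfl
  · have h2 : ∀ i, ∫⁻ x, gaussianPDF 0 (v i) x ^ 2 = gapWeight (v i) := by
      intro i
      have hvi : (0 : ℝ) < v i := NNReal.coe_pos.2 (pos_iff_ne_zero.2 (hv i))
      have h3 : ∀ x, gaussianPDF 0 (v i) x ^ 2
          = gapWeight (v i) * gaussianPDF 0 (v i / 2) x := by
        intro x
        rw [gapWeight_of_pos hvi, gaussianPDF, gaussianPDF,
          ← ENNReal.ofReal_pow (gaussianPDFReal_nonneg _ _ _), ← ENNReal.ofReal_mul (by positivity)]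
        congr 1
        unfold gaussianPDFReal
        rw [mul_pow, ← Real.exp_nat_mul, inv_pow, Real.sq_sqrt (by positivity),
          Real.rpow_neg (by positivity), ← Real.sqrt_eq_rpow, ← mul_assoc, ← mul_inv,
          ← Real.sqrt_mul (by positivity)]
        push_cast
        rw [show 4 * Real.pi * (v i : ℝ) * (2 * Real.pi * (v i / 2)) = (2 * Real.pi * v i) ^ 2 by ring,
          Real.sqrt_sq (by positivity)]
        congr 2
        field_simp
      simp_rw [h3]
      rw [lintegral_const_mul _ (measurable_gaussianPDF _ _),
        lintegral_gaussianPDF_eq_one 0 (by simpa using hv i), mul_one]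
    simp_rw [← h2]
    rw [volume_pi, ← lintegral_pi_prod _ fun i => (measurable_gaussianPDF 0 (v i)).pow_const 2]
    refine (lintegral_congr fun x => ?_).le
    rw [ENNReal.ofReal_prod_of_nonneg fun i _ => gaussianPDFReal_nonneg _ _ _, ← Finset.prod_pow]
    rfl

/-- The linear map sending `(x₀, …, x_{n-1})` to its increments `(x₀, x₁ - x₀, …)`. -/
def incrementMap (n : ℕ) : (Fin n → ℝ) →ₗ[ℝ] (Fin n → ℝ) where
  toFun x i := x i - Fin.cons (α := fun _ => ℝ) 0 x i.castSucc
  map_add' x y := by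
    ext ⟨i, hi⟩
    cases i with
    | zero => simp
    | succ i =>
      change x _ + y _ - (x ⟨i, _⟩ + y ⟨i, _⟩) = (x _ - x ⟨i, _⟩) + (y _ - y ⟨i, _⟩)
      ring
  map_smul' c x := by
    ext ⟨i, hi⟩
    cases i with
    | zero => simp
    | succ i =>
      change c * x _ - c * x ⟨i, _⟩ = c * (x _ - x ⟨i, _⟩)
      ring

theorem det_incrementMap (n : ℕ) : LinearMap.det (incrementMap n) = 1 := by
  rw [← LinearMap.det_toMatrix', Matrix.det_of_isLowerTriangular]
  · refine Finset.prod_eq_one fun i _ => ?_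
    rw [LinearMap.toMatrix'_apply]
    rcases i with ⟨_ | i, hi⟩
    · simp [incrementMap]
    · change (Pi.single _ 1 : Fin n → ℝ) _ - (Pi.single _ 1 : Fin n → ℝ) ⟨i, _⟩ = 1
      simp [Fin.ext_iff]
  · intro i j hij
    have hij : i < j := hij
    rw [LinearMap.toMatrix'_apply]
    rcases i with ⟨_ | i, hi⟩
    · simp [incrementMap, hij.ne]
    · change (Pi.single _ 1 : Fin n → ℝ) _ - (Pi.single _ 1 : Fin n → ℝ) ⟨i, _⟩ = 0
      have h2 : (⟨i, by omega⟩ : Fin n) ≠ j := by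
        intro h
        rw [← h, Fin.lt_def] at hij
        simp at hij
      rw [Pi.single_eq_of_ne hij.ne, Pi.single_eq_of_ne h2, sub_zero]

variable {Ω : Type*} [MeasurableSpace Ω] {P : Measure Ω} {B B₁ B₂ : ℝ≥0 → Ω → ℝ}

theorem gap_ne_zero_of_chainWeight_ne_top {n : ℕ} {s : Fin n → ℝ} {a : ℝ}
    (hgap : ∀ i : Fin n, 0 ≤ s i - Fin.cons (α := fun _ => ℝ) a s i.castSucc)
    (h : chainWeight a s ≠ ∞) (i : Fin n) :
    s i - Fin.cons (α := fun _ => ℝ) a s i.castSucc ≠ 0 := by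
  intro h0
  refine h ?_
  rw [chainWeight, ← Finset.mul_prod_erase _ _ (Finset.mem_univ i), h0, gapWeight_zero,
    ENNReal.top_mul]
  exact Finset.prod_ne_zero_iff.2 fun j _ => (gapWeight_pos (hgap j)).ne'

/-- At increasing times, the increments of a Brownian motion are independent Gaussian variables, and
the map from positions to increments is linear with determinant `1`. -/
theorem hasSquareDensity_of_monotone (hB : IsPreBrownianReal B P) {n : ℕ} {s : Fin n → ℝ≥0}
    (hs : Monotone s) (hw : chainWeight 0 (fun i => (s i : ℝ)) ≠ ∞) :
    HasSquareDensity (P.map fun ω i => B (s i) ω) (chainWeight 0 fun i => (s i : ℝ)) := by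
  have : IsProbabilityMeasure P := hB.isGaussianProcess.isProbabilityMeasure
  -- The times preceded by `0`, so that the first increment is the first position.
  set t : Fin (n + 1) → ℝ≥0 := Fin.cons 0 s with ht
  have htm : Monotone t := by
    intro i j hij
    cases i using Fin.cases with
    | zero => simp [ht]
    | succ i =>
      cases j using Fin.cases with
      | zero => simp at hij
      | succ j => simpa [ht] using hs (by simpa using hij)
  have hcast : ∀ j : Fin (n + 1),
      (t j : ℝ) = Fin.cons (α := fun _ => ℝ) 0 (fun i => (s i : ℝ)) j := by
    intro j
    cases j using Fin.cases <;> simp [ht]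
  have htsucc : ∀ i : Fin n, t i.succ = s i := fun i => by simp [ht]
  have hgap : ∀ i : Fin n,
      0 ≤ (s i : ℝ) - Fin.cons (α := fun _ => ℝ) 0 (fun i => (s i : ℝ)) i.castSucc := by
    intro i
    rw [← hcast, ← htsucc i, sub_nonneg, NNReal.coe_le_coe]
    exact htm (Fin.castSucc_lt_succ).le
  set v : Fin n → ℝ≥0 := fun i => nndist (t i.succ).1 (t i.castSucc).1 with hvdef
  have hv : ∀ i, (v i : ℝ)
      = (s i : ℝ) - Fin.cons (α := fun _ => ℝ) 0 (fun i => (s i : ℝ)) i.castSucc := by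
    intro i
    simp only [hvdef, coe_nndist, Real.dist_eq]
    rw [← abs_of_nonneg (hgap i), ← hcast, ← htsucc i]
    rfl
  have hv0 : ∀ i, v i ≠ 0 := by
    intro i h0
    exact gap_ne_zero_of_chainWeight_ne_top hgap hw i (by rw [← hv, h0, NNReal.coe_zero])
  have hden := hasSquareDensity_pi_gaussianReal hv0
  have hC : ∏ i, gapWeight (v i) = chainWeight 0 fun i => (s i : ℝ) := by
    simp_rw [hv]; rfl
  rw [hC] at hden
  have hinc := hB.hasIndepIncrements n t htm
  have haem : ∀ i : Fin n, AEMeasurable (fun ω => B (t i.succ) ω - B (t i.castSucc) ω) P := fun i =>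
    (hB.aemeasurable _).sub (hB.aemeasurable _)
  have hlaw : P.map (fun ω (i : Fin n) => B (t i.succ) ω - B (t i.castSucc) ω)
      = Measure.pi fun i => gaussianReal 0 (v i) := by
    rw [(iIndepFun_iff_map_fun_eq_pi_map haem).1 hinc]
    congr 1 with i : 1
    exact (hB.hasLaw_sub _ _).map_eq
  rw [← hlaw] at hden
  have hdet : LinearMap.det (incrementMap n) ≠ 0 := by rw [det_incrementMap]; exact one_ne_zero
  let e : (Fin n → ℝ) ≃ₜ (Fin n → ℝ) :=
    ((incrementMap n).equivOfDetNeZero hdet).toContinuousLinearEquiv.toHomeomorph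
  have hecoe : ∀ x, e x = incrementMap n x := fun x => rfl
  have he : MeasurePreserving e := by
    refine ⟨e.measurable, ?_⟩
    have := Real.map_linearMap_volume_pi_eq_smul_volume_pi hdet
    rw [det_incrementMap] at this
    change Measure.map (incrementMap n) volume = volume
    simpa using this
  have he' : MeasurePreserving e.symm := MeasurePreserving.symm e.toMeasurableEquiv he
  convert hden.map e.symm he' using 1
  rw [AEMeasurable.map_map_of_aemeasurable e.symm.measurable.aemeasurable
    (aemeasurable_pi_lambda _ haem)]
  refine Measure.map_congr ?_
  filter_upwards [hB.eval_zero_ae_eq_zero] with ω hω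
  rw [Function.comp_apply, Homeomorph.eq_symm_apply, hecoe]
  ext i
  change B (s i) ω - Fin.cons (α := fun _ => ℝ) 0 (fun i => B (s i) ω) i.castSucc = _
  rw [htsucc]
  congr 1
  generalize i.castSucc = j
  cases j using Fin.cases <;> simp [ht, hω]

theorem hasSquareDensity_brownian (hB : IsPreBrownianReal B P) {n : ℕ} {s : Fin n → ℝ≥0}
    (hw : symWeight (fun i => (s i : ℝ)) ≠ ∞) :
    HasSquareDensity (P.map fun ω i => B (s i) ω) (symWeight fun i => (s i : ℝ)) := by
  set σ := Tuple.sort s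
  have hle : chainWeight 0 (fun i => ((s ∘ σ) i : ℝ)) ≤ symWeight (fun i => (s i : ℝ)) :=
    Finset.single_le_sum (f := fun σ : Equiv.Perm (Fin n) =>
      chainWeight 0 ((fun i => (s i : ℝ)) ∘ σ)) (fun _ _ => zero_le) (Finset.mem_univ σ)
  have h := hasSquareDensity_of_monotone hB (Tuple.monotone_sort s) (ne_top_of_le_ne_top hw hle)
  let e : (Fin n → ℝ) ≃ₜ (Fin n → ℝ) := Homeomorph.piCongrLeft (Y := fun _ => ℝ) σ
  have he : MeasurePreserving e := volume_measurePreserving_piCongrLeft (fun _ : Fin n => ℝ) σ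
  have h2 := h.map e he
  rw [AEMeasurable.map_map_of_aemeasurable e.measurable.aemeasurable
    (aemeasurable_pi_lambda _ fun i => hB.aemeasurable _)] at h2
  have h3 : (e ∘ fun ω i => B ((s ∘ σ) i) ω) = fun ω i => B (s i) ω := by
    ext ω i
    obtain ⟨j, rfl⟩ := σ.surjective i
    exact Equiv.piCongrLeft_apply_apply (fun _ : Fin n => ℝ) σ _ j
  rw [← h3]
  obtain ⟨g, h4, h5, h6, h7, h8⟩ := h2
  exact ⟨g, h4, h5, h6, h7, h8.trans hle⟩

/-! ### Mollified coincidence of two independent vectors -/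

theorem heatKernel_eq_gaussianPDFReal {ε : ℝ} (hε : 0 < ε) (x : ℝ) :
    heatKernel ε x = gaussianPDFReal 0 ε.toNNReal x := by
  rw [heatKernel, gaussianPDFReal, Real.rpow_neg (by positivity), ← Real.sqrt_eq_rpow, sq_abs,
    Real.coe_toNNReal _ hε.le, sub_zero]

theorem heatKernel_nonneg {ε : ℝ} (hε : 0 < ε) (x : ℝ) : 0 ≤ heatKernel ε x := by
  rw [heatKernel_eq_gaussianPDFReal hε]
  exact gaussianPDFReal_nonneg _ _ _

@[fun_prop]
theorem measurable_heatKernel (ε : ℝ) : Measurable (heatKernel ε) := by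
  unfold heatKernel
  fun_prop

/-- The product heat kernel `∏ᵢ p_{εᵢ}(zᵢ)`, with values in `[0,∞]`. -/
noncomputable def mollifier {n : ℕ} (ε : Fin n → ℝ) (z : Fin n → ℝ) : ℝ≥0∞ :=
  ∏ i, ENNReal.ofReal (heatKernel (ε i) (z i))

@[fun_prop]
theorem measurable_mollifier {n : ℕ} (ε : Fin n → ℝ) : Measurable (mollifier ε) := by
  unfold mollifier
  fun_prop

theorem ofReal_heatKernel {ε : ℝ} (hε : 0 < ε) (x : ℝ) :
    ENNReal.ofReal (heatKernel ε x) = gaussianPDF 0 ε.toNNReal x := by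
  rw [heatKernel_eq_gaussianPDFReal hε, gaussianPDF]

theorem withDensity_mollifier {n : ℕ} {ε : Fin n → ℝ} (hε : ∀ i, 0 < ε i) :
    volume.withDensity (mollifier ε) = Measure.pi fun i => gaussianReal 0 (ε i).toNNReal := by
  have h1 : ∀ i, gaussianReal 0 (ε i).toNNReal
      = volume.withDensity (gaussianPDF 0 (ε i).toNNReal) := fun i =>
    gaussianReal_of_var_ne_zero 0 (by simpa using hε i)
  have : ∀ i, SigmaFinite (volume.withDensity (gaussianPDF 0 (ε i).toNNReal)) := fun i => by
    rw [← h1]; infer_instance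
  simp_rw [h1]
  rw [pi_withDensity _ (fun i => measurable_gaussianPDF 0 _), volume_pi]
  congr 1 with z
  exact Finset.prod_congr rfl fun i _ => ofReal_heatKernel (hε i) _

theorem lintegral_mollifier {n : ℕ} {ε : Fin n → ℝ} (hε : ∀ i, 0 < ε i) :
    ∫⁻ z, mollifier ε z = 1 := by
  rw [← setLIntegral_univ, ← withDensity_apply _ MeasurableSet.univ, withDensity_mollifier hε]
  exact measure_univ

/-- By the inequality `g₁ g₂ ≤ (g₁² + g₂²) / 2` between densities, the mollified probability that
two independent vectors coincide is controlled by the `L²` norms of their densities. -/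
theorem lintegral_mollifier_sub_le {n : ℕ} {ε : Fin n → ℝ} (hε : ∀ i, 0 < ε i)
    {μ₁ μ₂ : Measure (Fin n → ℝ)} {C₁ C₂ : ℝ≥0∞} (h₁ : HasSquareDensity μ₁ C₁)
    (h₂ : HasSquareDensity μ₂ C₂) :
    ∫⁻ y, ∫⁻ x, mollifier ε (x - y) ∂μ₁ ∂μ₂ ≤ (C₁ + C₂) / 2 := by
  obtain ⟨g₁, hc₁, hn₁, -, rfl, hC₁⟩ := h₁
  obtain ⟨g₂, hc₂, hn₂, -, rfl, hC₂⟩ := h₂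
  have hm₁ : Measurable fun x => ENNReal.ofReal (g₁ x) := by fun_prop
  have hm₂ : Measurable fun x => ENNReal.ofReal (g₂ x) := by fun_prop
  have hk : Measurable fun p : (Fin n → ℝ) × (Fin n → ℝ) => mollifier ε (p.2 - p.1) := by fun_prop
  have hky : ∀ y, Measurable fun x : Fin n → ℝ => mollifier ε (x - y) := fun y => by fun_prop
  have hkx : ∀ x, Measurable fun y : Fin n → ℝ => mollifier ε (x - y) := fun y => by fun_prop
  have ham : ∀ x y, ENNReal.ofReal (g₂ y) * ENNReal.ofReal (g₁ x)
      ≤ 2⁻¹ * (ENNReal.ofReal (g₁ x) ^ 2 + ENNReal.ofReal (g₂ y) ^ 2) := by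
    intro x y
    rw [← ENNReal.ofReal_pow (hn₁ x), ← ENNReal.ofReal_pow (hn₂ y),
      ← ENNReal.ofReal_add (sq_nonneg _) (sq_nonneg _), ← ENNReal.ofReal_mul (hn₂ y),
      show (2 : ℝ≥0∞)⁻¹ = ENNReal.ofReal (2⁻¹) by
        rw [ENNReal.ofReal_inv_of_pos two_pos, ENNReal.ofReal_ofNat],
      ← ENNReal.ofReal_mul (by norm_num)]
    exact ENNReal.ofReal_le_ofReal (by nlinarith [sq_nonneg (g₁ x - g₂ y)])
  calc _ = ∫⁻ y, ∫⁻ x, ENNReal.ofReal (g₂ y) * ENNReal.ofReal (g₁ x) * mollifier ε (x - y) := by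
        rw [lintegral_withDensity_eq_lintegral_mul _ hm₂
          (Measurable.lintegral_prod_right' hk)]
        refine lintegral_congr fun y => ?_
        rw [Pi.mul_apply, lintegral_withDensity_eq_lintegral_mul _ hm₁ (hky y),
          ← lintegral_const_mul _ (by fun_prop)]
        exact lintegral_congr fun x => by rw [Pi.mul_apply, mul_assoc]
    _ ≤ ∫⁻ y, ∫⁻ x, (2⁻¹ * (ENNReal.ofReal (g₁ x) ^ 2 * mollifier ε (x - y))
          + 2⁻¹ * (ENNReal.ofReal (g₂ y) ^ 2 * mollifier ε (x - y))) := by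
        refine lintegral_mono fun y => lintegral_mono fun x => ?_
        calc _ ≤ _ := mul_le_mul_left (ham x y) _
          _ = _ := by ring
    _ = 2⁻¹ * (∫⁻ y, ∫⁻ x, ENNReal.ofReal (g₁ x) ^ 2 * mollifier ε (x - y))
          + 2⁻¹ * (∫⁻ y, ∫⁻ x, ENNReal.ofReal (g₂ y) ^ 2 * mollifier ε (x - y)) := by
        have h3 : ∀ y, ∫⁻ x, (2⁻¹ * (ENNReal.ofReal (g₁ x) ^ 2 * mollifier ε (x - y))
            + 2⁻¹ * (ENNReal.ofReal (g₂ y) ^ 2 * mollifier ε (x - y)))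
            = 2⁻¹ * (∫⁻ x, ENNReal.ofReal (g₁ x) ^ 2 * mollifier ε (x - y))
              + 2⁻¹ * ∫⁻ x, ENNReal.ofReal (g₂ y) ^ 2 * mollifier ε (x - y) := by
          intro y
          rw [lintegral_add_left (by fun_prop), lintegral_const_mul _ (by fun_prop),
            lintegral_const_mul _ (by fun_prop)]
        simp_rw [h3]
        have h4 : Measurable fun y => ∫⁻ x, ENNReal.ofReal (g₁ x) ^ 2 * mollifier ε (x - y) :=
          Measurable.lintegral_prod_right' (f := fun p : (Fin n → ℝ) × (Fin n → ℝ) =>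
            ENNReal.ofReal (g₁ p.2) ^ 2 * mollifier ε (p.2 - p.1)) (by fun_prop)
        have h5 : Measurable fun y => ∫⁻ x, ENNReal.ofReal (g₂ y) ^ 2 * mollifier ε (x - y) :=
          Measurable.lintegral_prod_right' (f := fun p : (Fin n → ℝ) × (Fin n → ℝ) =>
            ENNReal.ofReal (g₂ p.1) ^ 2 * mollifier ε (p.2 - p.1)) (by fun_prop)
        rw [lintegral_add_left (h4.const_mul _), lintegral_const_mul _ h4,
          lintegral_const_mul _ h5]
    _ = 2⁻¹ * (∫⁻ x, ENNReal.ofReal (g₁ x) ^ 2) + 2⁻¹ * ∫⁻ y, ENNReal.ofReal (g₂ y) ^ 2 := by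
        congr 2
        · rw [lintegral_lintegral_swap (by fun_prop)]
          refine lintegral_congr fun x => ?_
          rw [lintegral_const_mul _ (hkx x), lintegral_sub_left_eq_self (mollifier ε),
            lintegral_mollifier hε, mul_one]
        · refine lintegral_congr fun y => ?_
          rw [lintegral_const_mul _ (hky y), lintegral_sub_right_eq_self (mollifier ε),
            lintegral_mollifier hε, mul_one]
    _ ≤ 2⁻¹ * C₁ + 2⁻¹ * C₂ := by gcongr
    _ = _ := by rw [ENNReal.div_eq_inv_mul, mul_add]

/-- A variable with density `mollifier ε` is a standard Gaussian vector scaled by the `√εᵢ`. -/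
theorem lintegral_mul_mollifier {n : ℕ} {ε : Fin n → ℝ} (hε : ∀ i, 0 < ε i)
    {f : (Fin n → ℝ) → ℝ≥0∞} (hf : Measurable f) :
    ∫⁻ z, mollifier ε z * f z
      = ∫⁻ u, f (fun i => √(ε i) * u i) ∂Measure.pi (fun _ : Fin n => gaussianReal 0 1) := by
  have h1 : ∀ i : Fin n, MeasurePreserving (fun u => √(ε i) * u) (gaussianReal 0 1)
      (gaussianReal 0 (ε i).toNNReal) := by
    intro i
    refine ⟨by fun_prop, ?_⟩
    rw [gaussianReal_map_const_mul]
    congr 1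
    · simp
    · ext
      simp [(hε i).le]
  have h2 := measurePreserving_pi (fun _ : Fin n => gaussianReal 0 1)
    (fun i => gaussianReal 0 (ε i).toNNReal) h1
  rw [h2.lintegral_comp hf, ← withDensity_mollifier hε,
    lintegral_withDensity_eq_lintegral_mul _ (measurable_mollifier ε) hf]
  rfl

/-- If one of two independent vectors has a continuous bounded density, the mollified probability
that they coincide converges as the mollification is removed. -/
theorem exists_tendsto_lintegral_mollifier_sub {n : ℕ} {μ₁ μ₂ : Measure (Fin n → ℝ)}
    [IsFiniteMeasure μ₂] {C : ℝ≥0∞} (h₁ : HasSquareDensity μ₁ C) :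
    ∃ L : ℝ≥0∞, ∀ {ι : Type} (l : Filter ι) [l.IsCountablyGenerated] (ε : ι → Fin n → ℝ),
      (∀ᶠ a in l, ∀ i, 0 < ε a i) → (∀ i, Tendsto (fun a => ε a i) l (𝓝 0)) →
      Tendsto (fun a => ∫⁻ y, ∫⁻ x, mollifier (ε a) (x - y) ∂μ₁ ∂μ₂) l (𝓝 L) := by
  obtain ⟨g, hc, hn, ⟨M, hM⟩, rfl, -⟩ := h₁
  set γ : Measure (Fin n → ℝ) := Measure.pi fun _ : Fin n => gaussianReal 0 1
  refine ⟨∫⁻ p, ENNReal.ofReal (g p.1) ∂μ₂.prod γ, fun {ι} l _ ε hε hlim => ?_⟩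
  have hm : Measurable fun x => ENNReal.ofReal (g x) := by fun_prop
  have hF : ∀ a, Measurable fun p : (Fin n → ℝ) × (Fin n → ℝ) =>
      ENNReal.ofReal (g ((fun i => √(ε a i) * p.2 i) + p.1)) := fun a => by fun_prop
  have heq : ∀ᶠ a in l, ∫⁻ p, ENNReal.ofReal (g ((fun i => √(ε a i) * p.2 i) + p.1)) ∂μ₂.prod γ
      = ∫⁻ y, ∫⁻ x, mollifier (ε a) (x - y)
        ∂volume.withDensity (fun x => ENNReal.ofReal (g x)) ∂μ₂ := by
    filter_upwards [hε] with a ha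
    rw [lintegral_prod _ (hF a).aemeasurable]
    refine lintegral_congr fun y => ?_
    rw [lintegral_withDensity_eq_lintegral_mul _ hm (by fun_prop)]
    conv_rhs => rw [← lintegral_add_right_eq_self _ y]
    simp only [Pi.mul_apply, add_sub_cancel_right]
    simp_rw [mul_comm (ENNReal.ofReal _)]
    rw [lintegral_mul_mollifier ha (f := fun z => ENNReal.ofReal (g (z + y))) (by fun_prop)]
  refine Tendsto.congr' heq ?_
  refine tendsto_lintegral_filter_of_dominated_convergence (fun _ => ENNReal.ofReal M)
    (Eventually.of_forall hF) (Eventually.of_forall fun a => ae_of_all _ fun p =>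
      ENNReal.ofReal_le_ofReal (hM _)) ?_ (ae_of_all _ fun p => ?_)
  · rw [lintegral_const]
    exact ENNReal.mul_ne_top ENNReal.ofReal_ne_top (measure_ne_top _ _)
  · refine (ENNReal.continuous_ofReal.comp hc).continuousAt.tendsto.comp ?_
    have : Tendsto (fun a => (fun i => √(ε a i) * p.2 i) + p.1) l
        (𝓝 ((fun _ : Fin n => (0 : ℝ)) + p.1)) := by
      refine Tendsto.add_const _ (tendsto_pi_nhds.2 fun i => ?_)
      simpa using ((Real.continuous_sqrt.tendsto 0).comp (hlim i)).mul_const (p.2 i)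
    simpa [← Pi.zero_def] using this

/-! ### Moments of the mollified local times -/

/-- If `w` has marginal integrals at most `N`, a function of the first coordinates alone can be
separated from the product of the `w (qᵢ)` at the cost of a factor `N ^ n`. -/
theorem lintegral_prod_mul_fst_le {n : ℕ} {μ : Measure ℝ} [SigmaFinite μ] {w : ℝ × ℝ → ℝ≥0∞}
    (hw : Measurable w) {N : ℝ≥0∞} (hN : ∀ᵐ s ∂μ, ∫⁻ t, w (s, t) ∂μ ≤ N)
    {F : (Fin n → ℝ) → ℝ≥0∞} (hF : Measurable F) :
    ∫⁻ q, (∏ i, w (q i)) * F (fun i => (q i).1) ∂Measure.pi (fun _ : Fin n => μ.prod μ)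
      ≤ N ^ n * ∫⁻ s, F s ∂Measure.pi fun _ : Fin n => μ := by
  have h := (measurePreserving_arrowProdEquivProdArrow ℝ ℝ (Fin n) (fun _ => μ) fun _ => μ).symm
  have hm : Measurable fun q : Fin n → ℝ × ℝ => (∏ i, w (q i)) * F (fun i => (q i).1) := by
    refine Measurable.mul ?_ (hF.comp ?_)
    · exact Finset.measurable_prod _ fun i _ => hw.comp (measurable_pi_apply i)
    · exact measurable_pi_lambda _ fun i => (measurable_pi_apply i).fst
  rw [← h.lintegral_comp hm, lintegral_prod _ (by exact (hm.comp h.measurable).aemeasurable),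
    ← lintegral_const_mul _ hF]
  have hall : ∀ᵐ s ∂Measure.pi (fun _ : Fin n => μ), ∀ i, ∫⁻ t, w (s i, t) ∂μ ≤ N :=
    ae_all_iff.2 fun i => Measure.tendsto_eval_ae_ae.eventually (p := fun s => ∫⁻ t, w (s, t) ∂μ ≤ N) hN
  refine lintegral_mono_ae ?_
  filter_upwards [hall] with s hs
  change ∫⁻ t : Fin n → ℝ, (∏ i, w (s i, t i)) * F s ∂_ ≤ _
  rw [lintegral_mul_const _ (by
      exact Finset.measurable_prod _ fun i _ =>
        hw.comp (measurable_const.prodMk (measurable_pi_apply i))),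
    lintegral_pi_prod (fun _ => μ) (f := fun i t => w (s i, t))
      fun i => hw.comp (measurable_const.prodMk measurable_id)]
  gcongr
  calc _ ≤ ∏ _i : Fin n, N := Finset.prod_le_prod' fun i _ => hs i
    _ = N ^ n := by simp

theorem lintegral_prod_mul_snd_le {n : ℕ} {μ : Measure ℝ} [SigmaFinite μ] {w : ℝ × ℝ → ℝ≥0∞}
    (hw : Measurable w) {N : ℝ≥0∞} (hN : ∀ᵐ t ∂μ, ∫⁻ s, w (s, t) ∂μ ≤ N)
    {F : (Fin n → ℝ) → ℝ≥0∞} (hF : Measurable F) :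
    ∫⁻ q, (∏ i, w (q i)) * F (fun i => (q i).2) ∂Measure.pi (fun _ : Fin n => μ.prod μ)
      ≤ N ^ n * ∫⁻ s, F s ∂Measure.pi fun _ : Fin n => μ := by
  have h := measurePreserving_pi (fun _ : Fin n => μ.prod μ) (fun _ : Fin n => μ.prod μ)
    (f := fun _ => Prod.swap) (fun _ => Measure.measurePreserving_swap)
  have hm : Measurable fun q : Fin n → ℝ × ℝ => (∏ i, w (q i)) * F (fun i => (q i).2) := by
    refine Measurable.mul ?_ (hF.comp ?_)
    · exact Finset.measurable_prod _ fun i _ => hw.comp (measurable_pi_apply i)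
    · exact measurable_pi_lambda _ fun i => (measurable_pi_apply i).snd
  rw [← h.lintegral_comp hm]
  exact lintegral_prod_mul_fst_le (w := w ∘ Prod.swap) (hw.comp measurable_swap) hN hF

/-- The mean of the symmetrized gap weights of the two time vectors collected in `q`. It dominates
the mollified probability that the two motions coincide at these times. -/
noncomputable def pairWeight {n : ℕ} (q : Fin n → ℝ × ℝ) : ℝ≥0∞ :=
  (symWeight (fun i => ((q i).1.toNNReal : ℝ)) + symWeight (fun i => ((q i).2.toNNReal : ℝ))) / 2

theorem pairWeight_eq_top {n : ℕ} {q : Fin n → ℝ × ℝ}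
    (h : symWeight (fun i => ((q i).1.toNNReal : ℝ)) = ∞
      ∨ symWeight (fun i => ((q i).2.toNNReal : ℝ)) = ∞) : pairWeight q = ∞ := by
  rw [pairWeight, ENNReal.div_eq_top]
  exact Or.inr ⟨ENNReal.add_eq_top.2 h, ENNReal.ofNat_ne_top⟩

theorem measurable_symWeight_toNNReal {n : ℕ} :
    Measurable fun s : Fin n → ℝ => symWeight fun i => ((s i).toNNReal : ℝ) :=
  measurable_symWeight.comp (measurable_pi_lambda _ fun i => by fun_prop)

theorem measurable_pairWeight {n : ℕ} : Measurable (pairWeight (n := n)) := by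
  unfold pairWeight
  refine Measurable.div_const (Measurable.add ?_ ?_) _
  · exact measurable_symWeight_toNNReal.comp
      (measurable_pi_lambda _ fun i => (measurable_pi_apply i).fst)
  · exact measurable_symWeight_toNNReal.comp
      (measurable_pi_lambda _ fun i => (measurable_pi_apply i).snd)

/-- A bound for the normalized moment `E[Xⁿ] / n!` of the mollified local times. -/
noncomputable def momentBound (N : ℝ≥0∞) (T : ℝ) (n : ℕ) : ℝ≥0∞ :=
  N ^ n * ENNReal.ofReal (simplexCoeff n * T ^ ((n : ℝ) / 2))

theorem momentBound_ne_top {N : ℝ≥0∞} (hN : N ≠ ∞) (T : ℝ) (n : ℕ) : momentBound N T n ≠ ∞ :=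
  ENNReal.mul_ne_top (ENNReal.pow_ne_top hN) ENNReal.ofReal_ne_top

theorem lintegral_prod_mul_pairWeight_le (n : ℕ) {T : ℝ} (hT : 0 ≤ T) {w : ℝ × ℝ → ℝ≥0∞}
    (hw : Measurable w) {N : ℝ≥0∞}
    (hN₁ : ∀ s ∈ Set.Icc 0 T, ∫⁻ t in Set.Icc 0 T, w (s, t) ≤ N)
    (hN₂ : ∀ t ∈ Set.Icc 0 T, ∫⁻ s in Set.Icc 0 T, w (s, t) ≤ N) :
    ∫⁻ q, (∏ i, w (q i)) * pairWeight q ∂Measure.pi (fun _ : Fin n =>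
        (volume.restrict (Set.Icc 0 T)).prod (volume.restrict (Set.Icc 0 T)))
      ≤ n.factorial * momentBound N T n := by
  set μ : Measure ℝ := volume.restrict (Set.Icc 0 T) with hμ
  have hmem : ∀ᵐ s ∂μ, s ∈ Set.Icc 0 T := ae_restrict_mem measurableSet_Icc
  have hA : ∫⁻ s, symWeight (fun i => ((s i).toNNReal : ℝ)) ∂Measure.pi (fun _ : Fin n => μ)
      ≤ n.factorial * ENNReal.ofReal (simplexCoeff n * T ^ ((n : ℝ) / 2)) := by
    refine le_trans (lintegral_congr_ae ?_).le (lintegral_symWeight_le n hT)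
    have hall : ∀ᵐ s ∂Measure.pi (fun _ : Fin n => μ), ∀ i, s i ∈ Set.Icc 0 T :=
      ae_all_iff.2 fun i => Measure.tendsto_eval_ae_ae.eventually hmem
    filter_upwards [hall] with s hs
    congr 1 with i
    exact Real.coe_toNNReal _ (hs i).1
  have h1 := lintegral_prod_mul_fst_le hw (hmem.mono hN₁)
    (measurable_symWeight_toNNReal (n := n))
  have h2 := lintegral_prod_mul_snd_le hw (hmem.mono hN₂)
    (measurable_symWeight_toNNReal (n := n))
  have hwm : Measurable fun q : Fin n → ℝ × ℝ => ∏ i, w (q i) :=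
    Finset.measurable_prod _ fun i _ => hw.comp (measurable_pi_apply i)
  have hs1 : Measurable fun q : Fin n → ℝ × ℝ => symWeight (fun i => ((q i).1.toNNReal : ℝ)) :=
    measurable_symWeight_toNNReal.comp
      (measurable_pi_lambda _ fun i => (measurable_pi_apply i).fst)
  have hs2 : Measurable fun q : Fin n → ℝ × ℝ => symWeight (fun i => ((q i).2.toNNReal : ℝ)) :=
    measurable_symWeight_toNNReal.comp
      (measurable_pi_lambda _ fun i => (measurable_pi_apply i).snd)
  calc _ = 2⁻¹ * (∫⁻ q, (∏ i, w (q i)) * symWeight (fun i => ((q i).1.toNNReal : ℝ))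
            ∂Measure.pi (fun _ : Fin n => μ.prod μ)
          + ∫⁻ q, (∏ i, w (q i)) * symWeight (fun i => ((q i).2.toNNReal : ℝ))
            ∂Measure.pi (fun _ : Fin n => μ.prod μ)) := by
        rw [← lintegral_add_left (by exact hwm.mul hs1), ← lintegral_const_mul _
          (by exact (hwm.mul hs1).add (hwm.mul hs2))]
        refine lintegral_congr fun q => ?_
        rw [pairWeight, ENNReal.div_eq_inv_mul]
        ring
    _ ≤ 2⁻¹ * (n.factorial * momentBound N T n + n.factorial * momentBound N T n) := by
        have h3 : N ^ n * ∫⁻ s, symWeight (fun i => ((s i).toNNReal : ℝ))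
            ∂Measure.pi (fun _ : Fin n => μ) ≤ n.factorial * momentBound N T n := by
          calc _ ≤ N ^ n * _ := mul_le_mul_right hA _
            _ = _ := by rw [momentBound]; ring
        gcongr
        · exact h1.trans h3
        · exact h2.trans h3
    _ = _ := by
        rw [← two_mul, ← mul_assoc, ENNReal.inv_mul_cancel (by norm_num) (by norm_num), one_mul]

/-- The mollified probability `E ∏ᵢ p_{εᵢ}(B¹_{sᵢ} - B²_{tᵢ})` that the two motions coincide at the
pairs of times `qᵢ = (sᵢ, tᵢ)`. -/
noncomputable def coincidence (P : Measure Ω) (B₁ B₂ : ℝ≥0 → Ω → ℝ) {n : ℕ} (ε : Fin n → ℝ)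
    (q : Fin n → ℝ × ℝ) : ℝ≥0∞ :=
  ∫⁻ ω, mollifier ε (fun i => B₁ (q i).1.toNNReal ω - B₂ (q i).2.toNNReal ω) ∂P

theorem coincidence_eq [IsProbabilityMeasure P] (hB₁ : ∀ t, Measurable (B₁ t))
    (hB₂ : ∀ t, Measurable (B₂ t))
    (hindep : IndepFun (fun ω s => B₁ s ω) (fun ω t => B₂ t ω) P) {n : ℕ} (ε : Fin n → ℝ)
    (q : Fin n → ℝ × ℝ) :
    coincidence P B₁ B₂ ε q
      = ∫⁻ y, ∫⁻ x, mollifier ε (x - y) ∂(P.map fun ω i => B₁ (q i).1.toNNReal ω)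
        ∂(P.map fun ω i => B₂ (q i).2.toNNReal ω) := by
  have hm₁ : Measurable fun ω i => B₁ (q i).1.toNNReal ω := measurable_pi_lambda _ fun i => hB₁ _
  have hm₂ : Measurable fun ω i => B₂ (q i).2.toNNReal ω := measurable_pi_lambda _ fun i => hB₂ _
  have hi : IndepFun (fun ω i => B₁ (q i).1.toNNReal ω) (fun ω i => B₂ (q i).2.toNNReal ω) P :=
    hindep.comp (φ := fun x i => x (q i).1.toNNReal) (ψ := fun x i => x (q i).2.toNNReal)
      (measurable_pi_lambda _ fun i => measurable_pi_apply _)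
      (measurable_pi_lambda _ fun i => measurable_pi_apply _)
  have := Measure.isProbabilityMeasure_map (μ := P) hm₁.aemeasurable
  have := Measure.isProbabilityMeasure_map (μ := P) hm₂.aemeasurable
  rw [← lintegral_prod_symm' (fun p : (Fin n → ℝ) × (Fin n → ℝ) => mollifier ε (p.1 - p.2))
    (by fun_prop), ← (indepFun_iff_map_prod_eq_prod_map_map hm₁.aemeasurable
      hm₂.aemeasurable).1 hi, lintegral_map (by fun_prop) (hm₁.prodMk hm₂)]
  rfl

theorem coincidence_le [IsProbabilityMeasure P] (hB₁ : IsPreBrownianReal B₁ P)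
    (hB₂ : IsPreBrownianReal B₂ P) (hm₁ : ∀ t, Measurable (B₁ t)) (hm₂ : ∀ t, Measurable (B₂ t))
    (hindep : IndepFun (fun ω s => B₁ s ω) (fun ω t => B₂ t ω) P) {n : ℕ} {ε : Fin n → ℝ}
    (hε : ∀ i, 0 < ε i) (q : Fin n → ℝ × ℝ) :
    coincidence P B₁ B₂ ε q ≤ pairWeight q := by
  by_cases h₁ : symWeight (fun i => ((q i).1.toNNReal : ℝ)) = ∞
  · rw [pairWeight_eq_top (Or.inl h₁)]
    exact le_top
  by_cases h₂ : symWeight (fun i => ((q i).2.toNNReal : ℝ)) = ∞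
  · rw [pairWeight_eq_top (Or.inr h₂)]
    exact le_top
  rw [coincidence_eq hm₁ hm₂ hindep]
  exact lintegral_mollifier_sub_le hε (hasSquareDensity_brownian hB₁ h₁)
    (hasSquareDensity_brownian hB₂ h₂)

/-- The approximate weighted intersection local time as a Lebesgue integral over the square
`[0,T]²`, for a weight with values in `[0,∞]`. -/
noncomputable def mollifiedTime (B₁ B₂ : ℝ≥0 → Ω → ℝ) (w : ℝ × ℝ → ℝ≥0∞) (T ε : ℝ) (ω : Ω) :
    ℝ≥0∞ :=
  ∫⁻ q, w q * ENNReal.ofReal (heatKernel ε (B₁ q.1.toNNReal ω - B₂ q.2.toNNReal ω))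
    ∂(volume.restrict (Set.Icc 0 T)).prod (volume.restrict (Set.Icc 0 T))

theorem measurable_mollifiedTime_integrand (hm₁ : Measurable (Function.uncurry B₁))
    (hm₂ : Measurable (Function.uncurry B₂)) {w : ℝ × ℝ → ℝ≥0∞} (hw : Measurable w) (ε : ℝ) :
    Measurable fun p : Ω × (ℝ × ℝ) => w p.2 *
      ENNReal.ofReal (heatKernel ε (B₁ p.2.1.toNNReal p.1 - B₂ p.2.2.toNNReal p.1)) := by
  have h1 : Measurable fun p : Ω × (ℝ × ℝ) => B₁ p.2.1.toNNReal p.1 :=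
    hm₁.comp (f := fun p : Ω × (ℝ × ℝ) => (p.2.1.toNNReal, p.1)) (by fun_prop)
  have h2 : Measurable fun p : Ω × (ℝ × ℝ) => B₂ p.2.2.toNNReal p.1 :=
    hm₂.comp (f := fun p : Ω × (ℝ × ℝ) => (p.2.2.toNNReal, p.1)) (by fun_prop)
  exact (hw.comp measurable_snd).mul
    (((measurable_heatKernel ε).comp (h1.sub h2)).ennreal_ofReal)

theorem measurable_mollifiedTime (hm₁ : Measurable (Function.uncurry B₁))
    (hm₂ : Measurable (Function.uncurry B₂)) {w : ℝ × ℝ → ℝ≥0∞} (hw : Measurable w) (T ε : ℝ) :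
    Measurable (mollifiedTime B₁ B₂ w T ε) :=
  Measurable.lintegral_prod_right' (measurable_mollifiedTime_integrand hm₁ hm₂ hw ε)

/-- Tonelli's theorem expresses the mixed moments through the coincidence probabilities. -/
theorem lintegral_prod_mollifiedTime [SFinite P] (hm₁ : Measurable (Function.uncurry B₁))
    (hm₂ : Measurable (Function.uncurry B₂)) {w : ℝ × ℝ → ℝ≥0∞} (hw : Measurable w) (T : ℝ)
    {n : ℕ} (ε : Fin n → ℝ) :
    ∫⁻ ω, ∏ i, mollifiedTime B₁ B₂ w T (ε i) ω ∂P
      = ∫⁻ q, (∏ i, w (q i)) * coincidence P B₁ B₂ ε q ∂Measure.pi (fun _ : Fin n =>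
        (volume.restrict (Set.Icc 0 T)).prod (volume.restrict (Set.Icc 0 T))) := by
  have hmeas := measurable_mollifiedTime_integrand hm₁ hm₂ hw
  have hjoint : Measurable fun p : Ω × (Fin n → ℝ × ℝ) => ∏ i, (w (p.2 i) *
      ENNReal.ofReal (heatKernel (ε i) (B₁ (p.2 i).1.toNNReal p.1 - B₂ (p.2 i).2.toNNReal p.1))) :=
    Finset.measurable_prod _ fun i _ => (hmeas (ε i)).comp
      (measurable_fst.prodMk ((measurable_pi_apply i).comp measurable_snd))
  have h1 : ∀ ω, ∏ i, mollifiedTime B₁ B₂ w T (ε i) ω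
      = ∫⁻ q, ∏ i, (w (q i) *
        ENNReal.ofReal (heatKernel (ε i) (B₁ (q i).1.toNNReal ω - B₂ (q i).2.toNNReal ω)))
        ∂Measure.pi (fun _ : Fin n =>
          (volume.restrict (Set.Icc 0 T)).prod (volume.restrict (Set.Icc 0 T))) := by
    intro ω
    rw [lintegral_pi_prod _ (f := fun i q => w q *
      ENNReal.ofReal (heatKernel (ε i) (B₁ q.1.toNNReal ω - B₂ q.2.toNNReal ω)))
      fun i => (hmeas (ε i)).comp (measurable_const.prodMk measurable_id)]
    rfl
  simp_rw [h1]
  rw [lintegral_lintegral_swap hjoint.aemeasurable]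
  refine lintegral_congr fun q => ?_
  simp_rw [Finset.prod_mul_distrib]
  rw [lintegral_const_mul]
  · rfl
  · refine Finset.measurable_prod _ fun i _ => ENNReal.measurable_ofReal.comp
      ((measurable_heatKernel _).comp (Measurable.sub ?_ ?_))
    · exact hm₁.comp (measurable_const.prodMk measurable_id)
    · exact hm₂.comp (measurable_const.prodMk measurable_id)

theorem lintegral_mollifiedTime_pow_le [IsProbabilityMeasure P] (hB₁ : IsPreBrownianReal B₁ P)
    (hB₂ : IsPreBrownianReal B₂ P) (hm₁ : Measurable (Function.uncurry B₁))
    (hm₂ : Measurable (Function.uncurry B₂))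
    (hindep : IndepFun (fun ω s => B₁ s ω) (fun ω t => B₂ t ω) P)
    {w : ℝ × ℝ → ℝ≥0∞} (hw : Measurable w) {T : ℝ} (hT : 0 ≤ T) {N : ℝ≥0∞}
    (hN₁ : ∀ s ∈ Set.Icc 0 T, ∫⁻ t in Set.Icc 0 T, w (s, t) ≤ N)
    (hN₂ : ∀ t ∈ Set.Icc 0 T, ∫⁻ s in Set.Icc 0 T, w (s, t) ≤ N) {ε : ℝ} (hε : 0 < ε) (n : ℕ) :
    ∫⁻ ω, mollifiedTime B₁ B₂ w T ε ω ^ n ∂P ≤ n.factorial * momentBound N T n := by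
  have h := lintegral_prod_mollifiedTime (P := P) hm₁ hm₂ hw T (fun _ : Fin n => ε)
  simp only [Finset.prod_const, Finset.card_univ, Fintype.card_fin] at h
  rw [h]
  refine le_trans (lintegral_mono fun q => ?_) (lintegral_prod_mul_pairWeight_le n hT hw hN₁ hN₂)
  gcongr
  exact coincidence_le hB₁ hB₂ (fun t => hm₁.comp (measurable_const.prodMk measurable_id))
    (fun t => hm₂.comp (measurable_const.prodMk measurable_id)) hindep (fun _ => hε) q

/-- The mixed moments of the mollified local times converge as the mollification is removed. -/
theorem exists_tendsto_lintegral_prod_mollifiedTime [IsProbabilityMeasure P]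
    (hB₁ : IsPreBrownianReal B₁ P)
    (hB₂ : IsPreBrownianReal B₂ P) (hm₁ : Measurable (Function.uncurry B₁))
    (hm₂ : Measurable (Function.uncurry B₂))
    (hindep : IndepFun (fun ω s => B₁ s ω) (fun ω t => B₂ t ω) P)
    {w : ℝ × ℝ → ℝ≥0∞} (hw : Measurable w) {T : ℝ} (hT : 0 ≤ T) {N : ℝ≥0∞} (hN : N ≠ ∞)
    (hN₁ : ∀ s ∈ Set.Icc 0 T, ∫⁻ t in Set.Icc 0 T, w (s, t) ≤ N)
    (hN₂ : ∀ t ∈ Set.Icc 0 T, ∫⁻ s in Set.Icc 0 T, w (s, t) ≤ N) (n : ℕ) :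
    ∃ L : ℝ≥0∞, L ≠ ∞ ∧ ∀ {ι : Type} (l : Filter ι) [l.IsCountablyGenerated]
      (ε : ι → Fin n → ℝ),
      (∀ᶠ a in l, ∀ i, 0 < ε a i) → (∀ i, Tendsto (fun a => ε a i) l (𝓝 0)) →
      Tendsto (fun a => ∫⁻ ω, ∏ i, mollifiedTime B₁ B₂ w T (ε a i) ω ∂P) l (𝓝 L) := by
  have hmt₁ : ∀ t, Measurable (B₁ t) := fun t => hm₁.comp (measurable_const.prodMk measurable_id)
  have hmt₂ : ∀ t, Measurable (B₂ t) := fun t => hm₂.comp (measurable_const.prodMk measurable_id)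
  set ρ : Measure (Fin n → ℝ × ℝ) := Measure.pi (fun _ : Fin n =>
    (volume.restrict (Set.Icc 0 T)).prod (volume.restrict (Set.Icc 0 T))) with hρ
  have hbound := lintegral_prod_mul_pairWeight_le n hT hw hN₁ hN₂
  have hfin : ∫⁻ q, (∏ i, w (q i)) * pairWeight q ∂ρ ≠ ∞ :=
    ne_top_of_le_ne_top (ENNReal.mul_ne_top (by simp) (momentBound_ne_top hN T n)) hbound
  have hwm : Measurable fun q : Fin n → ℝ × ℝ => ∏ i, w (q i) :=
    Finset.measurable_prod _ fun i _ => hw.comp (measurable_pi_apply i)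
  -- Almost every `q` has a finite dominating weight. There, either the integrand
  -- vanishes for every `ε`, because some `w (qᵢ)` or the dominating `pairWeight q` is `0`, or the law
  -- of the first motion at the times of `q` has a density.
  have hlim : ∀ q : Fin n → ℝ × ℝ, ∃ L : ℝ≥0∞, (∏ i, w (q i)) * pairWeight q < ∞ →
      ∀ {ι : Type} (l : Filter ι) [l.IsCountablyGenerated] (ε : ι → Fin n → ℝ),
      (∀ᶠ a in l, ∀ i, 0 < ε a i) → (∀ i, Tendsto (fun a => ε a i) l (𝓝 0)) →
      Tendsto (fun a => (∏ i, w (q i)) * coincidence P B₁ B₂ (ε a) q) l (𝓝 L) := by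
    intro q
    by_cases hw0 : ∏ i, w (q i) = 0
    · refine ⟨0, fun _ ι l _ ε _ _ => ?_⟩
      simpa [hw0] using tendsto_const_nhds
    by_cases hpw : pairWeight q = ∞
    · refine ⟨0, fun h => ?_⟩
      rw [hpw, ENNReal.mul_top hw0] at h
      exact absurd h (lt_irrefl _)
    have h₁ : symWeight (fun i => ((q i).1.toNNReal : ℝ)) ≠ ∞ := by
      exact fun h => hpw (pairWeight_eq_top (Or.inl h))
    have hmq : Measurable fun ω i => B₂ (q i).2.toNNReal ω :=
      measurable_pi_lambda _ fun i => hmt₂ _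
    have := Measure.isProbabilityMeasure_map (μ := P) hmq.aemeasurable
    obtain ⟨L, hL⟩ := exists_tendsto_lintegral_mollifier_sub
      (μ₂ := P.map fun ω i => B₂ (q i).2.toNNReal ω) (hasSquareDensity_brownian hB₁ h₁)
    by_cases hwt : ∏ i, w (q i) = ∞
    · by_cases hp0 : pairWeight q = 0
      · refine ⟨0, fun _ ι l _ ε hε _ => ?_⟩
        refine tendsto_const_nhds.congr' ?_
        filter_upwards [hε] with a ha
        have := coincidence_le hB₁ hB₂ hmt₁ hmt₂ hindep ha q
        rw [hp0, nonpos_iff_eq_zero] at this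
        rw [this, mul_zero]
      · refine ⟨0, fun h => ?_⟩
        rw [hwt, ENNReal.top_mul hp0] at h
        exact absurd h (lt_irrefl _)
    · refine ⟨(∏ i, w (q i)) * L, fun _ ι l _ ε hε hε0 => ?_⟩
      refine ENNReal.Tendsto.const_mul ?_ (Or.inr hwt)
      simp_rw [coincidence_eq hmt₁ hmt₂ hindep]
      exact hL l ε hε hε0
  choose f hf using hlim
  have hcm : ∀ ε : Fin n → ℝ, Measurable (coincidence P B₁ B₂ ε) := by
    intro ε
    unfold coincidence
    refine Measurable.lintegral_prod_right' (f := fun p : (Fin n → ℝ × ℝ) × Ω =>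
      mollifier ε (fun i => B₁ (p.1 i).1.toNNReal p.2 - B₂ (p.1 i).2.toNNReal p.2)) ?_
    refine (measurable_mollifier ε).comp (measurable_pi_lambda _ fun i => Measurable.sub ?_ ?_)
    · exact hm₁.comp (f := fun p : (Fin n → ℝ × ℝ) × Ω => ((p.1 i).1.toNNReal, p.2)) (by fun_prop)
    · exact hm₂.comp (f := fun p : (Fin n → ℝ × ℝ) × Ω => ((p.1 i).2.toNNReal, p.2)) (by fun_prop)
  have hmain : ∀ {ι : Type} (l : Filter ι) [l.IsCountablyGenerated] (ε : ι → Fin n → ℝ),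
      (∀ᶠ a in l, ∀ i, 0 < ε a i) → (∀ i, Tendsto (fun a => ε a i) l (𝓝 0)) →
      Tendsto (fun a => ∫⁻ ω, ∏ i, mollifiedTime B₁ B₂ w T (ε a i) ω ∂P) l
        (𝓝 (∫⁻ q, f q ∂ρ)) := by
    intro ι l _ ε hε hε0
    simp_rw [lintegral_prod_mollifiedTime hm₁ hm₂ hw]
    refine tendsto_lintegral_filter_of_dominated_convergence _
      (Eventually.of_forall fun a => hwm.mul (hcm _)) ?_ hfin ?_
    · filter_upwards [hε] with a ha
      refine ae_of_all _ fun q => ?_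
      gcongr
      exact coincidence_le hB₁ hB₂ hmt₁ hmt₂ hindep ha q
    · filter_upwards [ae_lt_top (hwm.mul measurable_pairWeight) hfin] with q hq
      exact hf q hq l ε hε hε0
  refine ⟨∫⁻ q, f q ∂ρ, ?_, fun l _ => hmain l⟩
  have h0 := hmain (𝓝[>] (0 : ℝ)) (fun a _ => a)
    (eventually_mem_nhdsWithin.mono fun a ha _ => ha)
    (fun _ => tendsto_nhdsWithin_of_tendsto_nhds tendsto_id)
  refine ne_top_of_le_ne_top (ENNReal.mul_ne_top (by simp) (momentBound_ne_top hN T n))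
    (le_of_tendsto h0 ?_ : _ ≤ (n.factorial : ℝ≥0∞) * momentBound N T n)
  filter_upwards [eventually_mem_nhdsWithin] with a ha
  simpa using lintegral_mollifiedTime_pow_le hB₁ hB₂ hm₁ hm₂ hindep hw hT hN₁ hN₂ ha n

/-! ### Exponential moments -/

theorem summable_pow_div_Gamma (x : ℝ) :
    Summable fun n : ℕ => x ^ n / Real.Gamma ((n : ℝ) / 2 + 1) := by
  have hG : ∀ n : ℕ, 0 < Real.Gamma ((n : ℝ) / 2 + 1) := fun n =>
    Real.Gamma_pos_of_pos (by positivity)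
  rcases eq_or_ne x 0 with rfl | hx
  · refine summable_of_ne_finset_zero (s := {0}) fun n hn => ?_
    simp [zero_pow (Finset.notMem_singleton.1 hn)]
  -- Two consecutive terms of the same parity have ratio `x² / (n/2 + 1)`.
  have hratio : ∀ n : ℕ, ‖x ^ (n + 2) / Real.Gamma (((n + 2 : ℕ) : ℝ) / 2 + 1)‖
      / ‖x ^ n / Real.Gamma ((n : ℝ) / 2 + 1)‖ = x ^ 2 / ((n : ℝ) / 2 + 1) := by
    intro n
    have h1 : ((n + 2 : ℕ) : ℝ) / 2 + 1 = ((n : ℝ) / 2 + 1) + 1 := by push_cast; ring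
    have h2 := Real.Gamma_add_one (show (n : ℝ) / 2 + 1 ≠ 0 by positivity)
    have h3 := hG n
    rw [h1, h2, ← norm_div, pow_add]
    have h4 : x ^ n * x ^ 2 / (((n : ℝ) / 2 + 1) * Real.Gamma ((n : ℝ) / 2 + 1))
        / (x ^ n / Real.Gamma ((n : ℝ) / 2 + 1)) = x ^ 2 / ((n : ℝ) / 2 + 1) := by
      field_simp
    rw [h4, Real.norm_of_nonneg (by positivity)]
  have hne : ∀ n : ℕ, x ^ n / Real.Gamma ((n : ℝ) / 2 + 1) ≠ 0 := fun n =>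
    div_ne_zero (pow_ne_zero _ hx) (hG n).ne'
  have hsub : ∀ r : ℕ, Summable fun k : ℕ =>
      x ^ (2 * k + r) / Real.Gamma (((2 * k + r : ℕ) : ℝ) / 2 + 1) := by
    intro r
    refine summable_of_ratio_test_tendsto_lt_one zero_lt_one
      (Eventually.of_forall fun k => hne _) ?_
    have : ∀ k : ℕ, 2 * (k + 1) + r = 2 * k + r + 2 := fun k => by ring
    simp_rw [this, hratio]
    refine Tendsto.const_div_atTop ?_ _
    refine tendsto_atTop_mono (fun k => ?_) tendsto_natCast_atTop_atTop
    push_cast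
    have : (0 : ℝ) ≤ r := Nat.cast_nonneg r
    linarith
  exact Summable.even_add_odd (hsub 0) (hsub 1)

theorem tsum_momentBound {N : ℝ≥0∞} (hN : N ≠ ∞) {T : ℝ} (hT : 0 ≤ T) {lam : ℝ} (hlam : 0 ≤ lam) :
    ∑' n : ℕ, ENNReal.ofReal lam ^ n * momentBound N T n
      = ENNReal.ofReal (1 + Phi (√T / 2 * N.toReal * lam)) := by
  set x := √T / 2 * N.toReal * lam with hx
  have hx0 : 0 ≤ x := by positivity
  have hG : ∀ n : ℕ, 0 < Real.Gamma ((n : ℝ) / 2 + 1) := fun n =>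
    Real.Gamma_pos_of_pos (by positivity)
  have hterm : ∀ n : ℕ, ENNReal.ofReal lam ^ n * momentBound N T n
      = ENNReal.ofReal (x ^ n / Real.Gamma ((n : ℝ) / 2 + 1)) := by
    intro n
    have := hG n
    rw [momentBound, simplexCoeff, ← ENNReal.ofReal_toReal hN,
      ← ENNReal.ofReal_pow ENNReal.toReal_nonneg, ← ENNReal.ofReal_pow hlam,
      ← ENNReal.ofReal_mul (by positivity), ← ENNReal.ofReal_mul (by positivity)]
    congr 1
    have hsq : T ^ ((n : ℝ) / 2) = √T ^ n := by
      rw [Real.sqrt_eq_rpow, ← Real.rpow_natCast, ← Real.rpow_mul hT]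
      congr 1
      ring
    rw [hsq, hx, mul_pow, mul_pow, div_pow, div_pow, one_pow]
    ring
  have hsum := summable_pow_div_Gamma x
  simp_rw [hterm]
  rw [← ENNReal.ofReal_tsum_of_nonneg (fun n => div_nonneg (pow_nonneg hx0 n) (hG n).le) hsum,
    hsum.tsum_eq_zero_add, Phi]
  simp

theorem ofReal_exp_eq_tsum {x : ℝ} (hx : 0 ≤ x) :
    ENNReal.ofReal (Real.exp x) = ∑' n : ℕ, ENNReal.ofReal x ^ n / (n.factorial : ℝ≥0∞) := by
  have h := NormedSpace.expSeries_div_hasSum_exp x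
  rw [← Real.exp_eq_exp_ℝ] at h
  rw [← h.tsum_eq, ENNReal.ofReal_tsum_of_nonneg (fun n => by positivity) h.summable]
  refine tsum_congr fun n => ?_
  rw [ENNReal.ofReal_div_of_pos (by positivity), ENNReal.ofReal_pow hx, ENNReal.ofReal_natCast]

theorem lintegral_exp_le_of_moments {Y : Ω → ℝ≥0∞} (hY : Measurable Y) (hfin : ∀ ω, Y ω ≠ ∞)
    {m : ℕ → ℝ≥0∞} (hm : ∀ n, ∫⁻ ω, Y ω ^ n ∂P ≤ n.factorial * m n) {lam : ℝ} (hlam : 0 ≤ lam) :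
    ∫⁻ ω, ENNReal.ofReal (Real.exp (lam * (Y ω).toReal)) ∂P
      ≤ ∑' n : ℕ, ENNReal.ofReal lam ^ n * m n := by
  have h1 : ∀ ω, ENNReal.ofReal (Real.exp (lam * (Y ω).toReal))
      = ∑' n : ℕ, ENNReal.ofReal lam ^ n / (n.factorial : ℝ≥0∞) * Y ω ^ n := by
    intro ω
    rw [ofReal_exp_eq_tsum (mul_nonneg hlam ENNReal.toReal_nonneg)]
    refine tsum_congr fun n => ?_
    rw [ENNReal.ofReal_mul hlam, ENNReal.ofReal_toReal (hfin ω), mul_pow,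
      ENNReal.mul_div_right_comm]
  simp_rw [h1]
  rw [lintegral_tsum fun n => ((hY.pow_const n).const_mul _).aemeasurable]
  refine ENNReal.tsum_le_tsum fun n => ?_
  rw [lintegral_const_mul _ (hY.pow_const n)]
  calc _ ≤ ENNReal.ofReal lam ^ n / (n.factorial : ℝ≥0∞) * (n.factorial * m n) :=
        mul_le_mul_right (hm n) _
    _ = _ := by
        rw [← mul_assoc, ENNReal.div_mul_cancel (by exact_mod_cast n.factorial_ne_zero) (by simp)]

theorem integrable_and_integral_le_of_lintegral_le {f : Ω → ℝ} (hf : AEStronglyMeasurable f P)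
    (hf0 : ∀ ω, 0 ≤ f ω) {C : ℝ} (hC : 0 ≤ C)
    (h : ∫⁻ ω, ENNReal.ofReal (f ω) ∂P ≤ ENNReal.ofReal C) :
    Integrable f P ∧ ∫ ω, f ω ∂P ≤ C := by
  refine ⟨⟨hf, ?_⟩, ?_⟩
  · rw [hasFiniteIntegral_iff_ofReal (ae_of_all _ hf0)]
    exact h.trans_lt ENNReal.ofReal_lt_top
  · rw [integral_eq_lintegral_of_nonneg_ae (ae_of_all _ hf0) hf]
    exact ENNReal.toReal_le_of_le_ofReal hC h

/-! ### Convergence in all `Lᵖ` from moments -/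

/-- A family in a Hilbert space converges if its Gram matrix does, because
`‖x - y‖² = ‖x‖² - 2 ⟪x, y⟫ + ‖y‖²`. -/
theorem exists_tendsto_of_tendsto_inner {ι H : Type*} [NormedAddCommGroup H]
    [InnerProductSpace ℝ H] [CompleteSpace H] {l : Filter ι} [l.NeBot] {F : ι → H} {c : ℝ}
    (h : Tendsto (fun p : ι × ι => inner ℝ (F p.1) (F p.2)) (l ×ˢ l) (𝓝 c)) :
    ∃ x, Tendsto F l (𝓝 x) := by
  have h1 : Tendsto (fun p : ι × ι => ‖F p.1‖ ^ 2) (l ×ˢ l) (𝓝 c) := by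
    have := h.comp ((tendsto_fst (f := l) (g := l)).prodMk (tendsto_fst (f := l) (g := l)))
    simpa [Function.comp_def, real_inner_self_eq_norm_sq] using this
  have h2 : Tendsto (fun p : ι × ι => ‖F p.2‖ ^ 2) (l ×ˢ l) (𝓝 c) := by
    have := h.comp ((tendsto_snd (f := l) (g := l)).prodMk (tendsto_snd (f := l) (g := l)))
    simpa [Function.comp_def, real_inner_self_eq_norm_sq] using this
  have h3 : Tendsto (fun p : ι × ι => dist (F p.1) (F p.2)) (l ×ˢ l) (𝓝 0) := by
    have h4 : Tendsto (fun p : ι × ι => √(‖F p.1‖ ^ 2 - 2 * inner ℝ (F p.1) (F p.2) + ‖F p.2‖ ^ 2))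
        (l ×ˢ l) (𝓝 (√(c - 2 * c + c))) := ((h1.sub (h.const_mul 2)).add h2).sqrt
    rw [show c - 2 * c + c = 0 by ring, Real.sqrt_zero] at h4
    refine h4.congr fun p => ?_
    rw [← norm_sub_sq_real, Real.sqrt_sq (norm_nonneg _), dist_eq_norm]
  have hc : Cauchy (map F l) := by
    rw [cauchy_map_iff]
    refine ⟨inferInstance, ?_⟩
    rwa [Metric.uniformity_eq_comap_nhds_zero, tendsto_comap_iff]
  exact CompleteSpace.complete hc

theorem eLpNorm_natCast_pow {f : Ω → ℝ} {n : ℕ} (hn : n ≠ 0) :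
    eLpNorm f n P ^ n = ∫⁻ ω, ‖f ω‖ₑ ^ n ∂P := by
  have := eLpNorm_nnreal_pow_eq_lintegral (μ := P) (f := f) (p := (n : ℝ≥0))
    (by exact_mod_cast hn)
  simpa using this

/-- The Cauchy–Schwarz inequality for `|f| · |f| ^ (n - 1)`. -/
theorem eLpNorm_natCast_pow_sq_le {f : Ω → ℝ} (hf : AEStronglyMeasurable f P) {n : ℕ}
    (hn : 2 ≤ n) :
    (eLpNorm f n P ^ n) ^ 2
      ≤ eLpNorm f 2 P ^ 2 * eLpNorm f (2 * n - 2 : ℕ) P ^ (2 * n - 2) := by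
  have h2 := eLpNorm_natCast_pow (P := P) (f := f) two_ne_zero
  rw [Nat.cast_two] at h2
  rw [eLpNorm_natCast_pow (by omega), eLpNorm_natCast_pow (by omega), h2]
  have hm : AEMeasurable (fun ω => ‖f ω‖ₑ) P := hf.enorm
  have hh := ENNReal.lintegral_mul_le_Lp_mul_Lq P (Real.HolderConjugate.two_two) hm
    (hm.pow_const (n - 1))
  have h3 : ∀ ω, ((fun ω => ‖f ω‖ₑ) * fun ω => ‖f ω‖ₑ ^ (n - 1)) ω = ‖f ω‖ₑ ^ n := by
    intro ω
    rw [Pi.mul_apply, ← pow_succ', Nat.sub_add_cancel (by omega)]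
  simp_rw [h3] at hh
  calc (∫⁻ ω, ‖f ω‖ₑ ^ n ∂P) ^ 2 ≤ _ := pow_le_pow_left' hh 2
    _ = _ := by
      rw [mul_pow, ← ENNReal.rpow_natCast, ← ENNReal.rpow_mul, ← ENNReal.rpow_natCast,
        ← ENNReal.rpow_mul]
      have h4 : 1 / (2 : ℝ) * ((2 : ℕ) : ℝ) = 1 := by norm_num
      rw [h4, ENNReal.rpow_one, ENNReal.rpow_one]
      congr 1
      · exact lintegral_congr fun ω => by rw [← ENNReal.rpow_natCast]; norm_num
      · refine lintegral_congr fun ω => ?_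
        rw [ENNReal.rpow_ofNat, ← pow_mul]
        congr 1
        omega

theorem enorm_toReal {x : ℝ≥0∞} (hx : x ≠ ∞) : ‖x.toReal‖ₑ = x := by
  rw [Real.enorm_eq_ofReal ENNReal.toReal_nonneg, ENNReal.ofReal_toReal hx]

theorem memLp_toReal_of_lintegral_pow {Y : Ω → ℝ≥0∞} (hY : Measurable Y) (hfin : ∀ ω, Y ω ≠ ∞)
    {n : ℕ} (hn : n ≠ 0) (h : ∫⁻ ω, Y ω ^ n ∂P ≠ ∞) : MemLp (fun ω => (Y ω).toReal) n P := by
  refine ⟨hY.ennreal_toReal.aestronglyMeasurable, ?_⟩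
  have h1 := eLpNorm_natCast_pow (P := P) (f := fun ω => (Y ω).toReal) hn
  simp_rw [enorm_toReal (hfin _)] at h1
  by_contra h2
  rw [not_lt_top_iff.1 h2, ENNReal.top_pow hn] at h1
  exact h h1.symm

/-- A family of random variables whose moments are bounded and whose mixed second moments converge
has a limit in every `Lᵖ` with `p < ∞`: it is Cauchy in `L²`, and the bounds on higher moments
upgrade the convergence. -/
theorem exists_tendsto_eLpNorm [IsProbabilityMeasure P] {Y : ℝ → Ω → ℝ≥0∞}
    (hY : ∀ ε, Measurable (Y ε)) (hfin : ∀ ε, 0 < ε → ∀ ω, Y ε ω ≠ ∞) {K : ℕ → ℝ≥0∞}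
    (hK : ∀ n, K n ≠ ∞) (hmom : ∀ ε, 0 < ε → ∀ n : ℕ, ∫⁻ ω, Y ε ω ^ n ∂P ≤ K n)
    {L : ℝ≥0∞} (hL : L ≠ ∞)
    (hmix : Tendsto (fun p : ℝ × ℝ => ∫⁻ ω, Y p.1 ω * Y p.2 ω ∂P)
      (𝓝[>] (0 : ℝ) ×ˢ 𝓝[>] (0 : ℝ)) (𝓝 L)) :
    ∃ I : Ω → ℝ,
      (∀ p : ℝ≥0∞, 1 ≤ p → p ≠ ∞ →
        (∀ ε : ℝ, 0 < ε → MemLp (fun ω => (Y ε ω).toReal) p P) ∧ MemLp I p P ∧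
        Tendsto (fun ε : ℝ => eLpNorm (fun ω => (Y ε ω).toReal - I ω) p P) (𝓝[>] (0 : ℝ)) (𝓝 0)) ∧
      ∃ e : ℕ → ℝ, (∀ k, 0 < e k) ∧
        ∀ᵐ ω ∂P, Tendsto (fun k => (Y (e k) ω).toReal) atTop (𝓝 (I ω)) := by
  have hpos : ∀ᶠ ε in 𝓝[>] (0 : ℝ), 0 < ε := eventually_mem_nhdsWithin
  have hmem : ∀ ε : ℝ, 0 < ε → ∀ n : ℕ, n ≠ 0 → MemLp (fun ω => (Y ε ω).toReal) n P :=
    fun ε hε n hn => memLp_toReal_of_lintegral_pow (hY ε) (hfin ε hε) hn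
      (ne_top_of_le_ne_top (hK n) (hmom ε hε n))
  have hmem2 : ∀ ε : ℝ, 0 < ε → MemLp (fun ω => (Y ε ω).toReal) 2 P := fun ε hε => by
    exact_mod_cast hmem ε hε 2 two_ne_zero
  -- The `L²` limit.
  let F : ℝ → Lp ℝ 2 P := fun ε => if h : 0 < ε then (hmem2 ε h).toLp _ else 0
  have hF : ∀ ε, 0 < ε → F ε =ᵐ[P] fun ω => (Y ε ω).toReal := fun ε h => by
    simp only [F, dif_pos h]
    exact MemLp.coeFn_toLp _
  have hinner : Tendsto (fun p : ℝ × ℝ => inner ℝ (F p.1) (F p.2))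
      (𝓝[>] (0 : ℝ) ×ˢ 𝓝[>] (0 : ℝ)) (𝓝 L.toReal) := by
    refine ((ENNReal.tendsto_toReal hL).comp hmix).congr' ?_
    filter_upwards [hpos.prod_mk hpos] with p hp
    rw [L2.inner_def, Function.comp_apply, ← integral_toReal]
    · refine integral_congr_ae ?_
      filter_upwards [hF _ hp.1, hF _ hp.2] with ω h1 h2
      rw [h1, h2, ENNReal.toReal_mul]
      simp [mul_comm]
    · exact ((hY _).mul (hY _)).aemeasurable
    · exact ae_of_all _ fun ω => ENNReal.mul_lt_top (hfin _ hp.1 ω).lt_top (hfin _ hp.2 ω).lt_top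
  obtain ⟨I, hI⟩ := exists_tendsto_of_tendsto_inner hinner
  rw [Lp.tendsto_Lp_iff_tendsto_eLpNorm'] at hI
  have hI2 : Tendsto (fun ε : ℝ => eLpNorm (fun ω => (Y ε ω).toReal - I ω) 2 P)
      (𝓝[>] (0 : ℝ)) (𝓝 0) := by
    refine hI.congr' ?_
    filter_upwards [hpos] with ε hε
    refine eLpNorm_congr_ae ?_
    filter_upwards [hF ε hε] with ω h
    rw [Pi.sub_apply, h]
  have hIm : AEStronglyMeasurable I P := Lp.aestronglyMeasurable I
  have hXm : ∀ ε, AEStronglyMeasurable (fun ω => (Y ε ω).toReal) P := fun ε =>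
    (hY ε).ennreal_toReal.aestronglyMeasurable
  -- An almost surely convergent sequence.
  obtain ⟨e', he', hae'⟩ := (tendstoInMeasure_of_tendsto_eLpNorm two_ne_zero hXm hIm
    hI2).exists_seq_tendsto_ae'
  obtain ⟨k₀, hk₀⟩ := eventually_atTop.1 (he'.eventually hpos)
  have hpose : ∀ k, 0 < e' (k + k₀) := fun k => hk₀ _ (Nat.le_add_left _ _)
  have hae : ∀ᵐ ω ∂P, Tendsto (fun k => (Y (e' (k + k₀)) ω).toReal) atTop (𝓝 (I ω)) :=
    hae'.mono fun ω h => h.comp (tendsto_add_atTop_nat k₀)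
  -- Uniform bounds on the norms, which pass to the limit by Fatou's lemma.
  have hnorm : ∀ ε : ℝ, 0 < ε → ∀ n : ℕ, n ≠ 0 →
      eLpNorm (fun ω => (Y ε ω).toReal) n P ≤ K n ^ ((n : ℝ)⁻¹) := by
    intro ε hε n hn
    have h1 := eLpNorm_natCast_pow (P := P) (f := fun ω => (Y ε ω).toReal) hn
    simp_rw [enorm_toReal (hfin ε hε _)] at h1
    rw [ENNReal.le_rpow_inv_iff (by positivity), ENNReal.rpow_natCast, h1]
    exact hmom ε hε n
  have hInorm : ∀ n : ℕ, n ≠ 0 → eLpNorm I n P ≤ K n ^ ((n : ℝ)⁻¹) := by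
    intro n hn
    refine (Lp.eLpNorm_lim_le_liminf_eLpNorm (fun k => hXm (e' (k + k₀))) I hae).trans ?_
    refine liminf_le_of_le (by isBoundedDefault) fun b hb => ?_
    obtain ⟨k, hk⟩ := hb.exists
    exact hk.trans (hnorm _ (hpose k) n hn)
  have hKn : ∀ n : ℕ, K n ^ ((n : ℝ)⁻¹) ≠ ∞ := fun n =>
    ENNReal.rpow_ne_top_of_nonneg (by positivity) (hK n)
  refine ⟨I, fun p hp1 hp => ?_, fun k => e' (k + k₀), hpose, hae⟩
  obtain ⟨m, hm⟩ := ENNReal.exists_nat_gt hp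
  -- Interpolate `Lⁿ`, for an integer `n ≥ max p 2`, between `L²` and `L²ⁿ⁻²`.
  set n : ℕ := max m 2
  have hn2 : 2 ≤ n := le_max_right _ _
  have hpn : p ≤ (n : ℝ≥0∞) := hm.le.trans (by exact_mod_cast le_max_left m 2)
  have hInmem : MemLp I n P := ⟨hIm, (hInorm n (by omega)).trans_lt (hKn n).lt_top⟩
  refine ⟨fun ε hε => (hmem ε hε n (by omega)).mono_exponent hpn, hInmem.mono_exponent hpn, ?_⟩
  set j : ℕ := 2 * n - 2 with hj
  set C : ℝ≥0∞ := (2 * K j ^ ((j : ℝ)⁻¹)) ^ j with hC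
  have hCtop : C ≠ ∞ := ENNReal.pow_ne_top (ENNReal.mul_ne_top (by simp) (hKn j))
  have hbound : ∀ ε : ℝ, 0 < ε → eLpNorm (fun ω => (Y ε ω).toReal - I ω) p P
      ≤ ((eLpNorm (fun ω => (Y ε ω).toReal - I ω) 2 P ^ 2 * C) ^ ((2 : ℝ)⁻¹)) ^ ((n : ℝ)⁻¹) := by
    intro ε hε
    have hsub : AEStronglyMeasurable (fun ω => (Y ε ω).toReal - I ω) P := (hXm ε).sub hIm
    refine (eLpNorm_le_eLpNorm_of_exponent_le hpn hsub).trans ?_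
    rw [ENNReal.le_rpow_inv_iff (by positivity), ENNReal.rpow_natCast,
      ENNReal.le_rpow_inv_iff (by positivity), ENNReal.rpow_ofNat]
    refine (eLpNorm_natCast_pow_sq_le hsub hn2).trans ?_
    gcongr
    refine pow_le_pow_left' ?_ j
    rw [two_mul (K j ^ ((j : ℝ)⁻¹))]
    refine (eLpNorm_sub_le (hXm ε) hIm ?_).trans
      (add_le_add (hnorm ε hε j (by omega)) (hInorm j (by omega)))
    exact_mod_cast (by omega : 1 ≤ j)
  refine tendsto_of_tendsto_of_tendsto_of_le_of_le' tendsto_const_nhds ?_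
    (Eventually.of_forall fun _ => zero_le) (hpos.mono hbound)
  have h1 : Tendsto (fun ε => eLpNorm (fun ω => (Y ε ω).toReal - I ω) 2 P ^ 2 * C)
      (𝓝[>] (0 : ℝ)) (𝓝 (0 ^ 2 * C)) :=
    ENNReal.Tendsto.mul_const ((ENNReal.continuous_pow 2).continuousAt.tendsto.comp hI2)
      (Or.inr hCtop)
  have h2 := ((ENNReal.continuous_rpow_const (y := (n : ℝ)⁻¹)).tendsto _).comp
    (((ENNReal.continuous_rpow_const (y := (2 : ℝ)⁻¹)).tendsto _).comp h1)
  have hn0 : (0 : ℝ) < (n : ℝ)⁻¹ := by positivity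
  have h0 : ((0 ^ 2 * C : ℝ≥0∞) ^ ((2 : ℝ)⁻¹)) ^ ((n : ℝ)⁻¹) = 0 := by
    rw [zero_pow two_ne_zero, zero_mul, ENNReal.zero_rpow_of_pos (by norm_num),
      ENNReal.zero_rpow_of_pos hn0]
  rw [h0] at h2
  exact h2

/-! ### The approximate local times as Lebesgue integrals -/

/-- A Brownian motion agrees, outside a null set and at all times, with a process that is jointly
measurable and whose paths are all continuous. -/
theorem exists_measurable_modification (hB : IsBrownianReal B P) :
    ∃ B' : ℝ≥0 → Ω → ℝ, IsPreBrownianReal B' P ∧ Measurable (Function.uncurry B') ∧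
      ∀ᵐ ω ∂P, ∀ t, B t ω = B' t ω := by
  classical
  let d : ℕ → ℝ≥0 := TopologicalSpace.denseSeq ℝ≥0
  have hm : ∀ k, AEMeasurable (B (d k)) P := fun k => hB.aemeasurable _
  have hG : ∀ᵐ ω ∂P, Continuous (B · ω) ∧ ∀ k, B (d k) ω = (hm k).mk _ ω :=
    hB.cont.and (ae_all_iff.2 fun k => (hm k).ae_eq_mk)
  obtain ⟨S, hS, hSm, hSG⟩ := hG.exists_measurable_mem
  let B' : ℝ≥0 → Ω → ℝ := fun t => S.indicator (B t)
  have hae : ∀ᵐ ω ∂P, ∀ t, B t ω = B' t ω := by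
    filter_upwards [hS] with ω hω t
    exact (Set.indicator_of_mem hω _).symm
  have hcont : ∀ ω, Continuous fun t => B' t ω := by
    intro ω
    by_cases hω : ω ∈ S
    · simpa [B', hω] using (hSG ω hω).1
    · simpa [B', hω] using continuous_const
  have hmeas : ∀ t, Measurable (B' t) := by
    intro t
    obtain ⟨x, hx, hxt⟩ := mem_closure_iff_seq_limit.1
      (TopologicalSpace.denseRange_denseSeq ℝ≥0 t)
    choose k hk using hx
    refine measurable_of_tendsto_metrizable (f := fun n => S.indicator ((hm (k n)).mk _))
      (fun n => (hm (k n)).measurable_mk.indicator hSm) (tendsto_pi_nhds.2 fun ω => ?_)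
    have h1 := ((hcont ω).tendsto t).comp hxt
    refine h1.congr fun n => ?_
    simp only [Function.comp_apply, B', Set.indicator_apply]
    split_ifs with hω
    · rw [← hk n]
      exact (hSG ω hω).2 (k n)
    · rfl
  exact ⟨B', hB.toIsPreBrownianReal.congr fun t => hae.mono fun ω h => h t,
    measurable_uncurry_of_continuous_of_measurable hcont hmeas, hae⟩

theorem heatKernel_le {ε : ℝ} (hε : 0 < ε) (x : ℝ) :
    heatKernel ε x ≤ (2 * Real.pi * ε) ^ (-(1 / 2 : ℝ)) := by
  refine mul_le_of_le_one_right (by positivity) (Real.exp_le_one_iff.2 ?_)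
  exact div_nonpos_of_nonpos_of_nonneg (neg_nonpos.2 (sq_nonneg _)) (by positivity)

/-- The weight `η` as an `[0,∞]`-valued function on the plane, extended by `0` off the quadrant. -/
noncomputable def extendedWeight (η : ℝ → ℝ → ℝ) : ℝ × ℝ → ℝ≥0∞ :=
  (Set.Ici (0 : ℝ) ×ˢ Set.Ici (0 : ℝ)).indicator fun q => ENNReal.ofReal (η q.1 q.2)

theorem measurable_extendedWeight {η : ℝ → ℝ → ℝ} (hη : IsWeight η) :
    Measurable (extendedWeight η) := by
  have hS : MeasurableSet (Set.Ici (0 : ℝ) ×ˢ Set.Ici (0 : ℝ)) :=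
    measurableSet_Ici.prod measurableSet_Ici
  refine measurable_of_restrict_of_restrict_compl hS ?_ ?_
  · have h := hη.measurable.ennreal_ofReal
    convert h using 1
    ext q
    exact Set.indicator_of_mem q.2 fun q : ℝ × ℝ => ENNReal.ofReal (η q.1 q.2)
  · convert (measurable_const : Measurable fun _ : _ => (0 : ℝ≥0∞)) using 1
    ext q
    exact Set.indicator_of_notMem q.2 fun q : ℝ × ℝ => ENNReal.ofReal (η q.1 q.2)

theorem extendedWeight_apply {η : ℝ → ℝ → ℝ} {s t : ℝ} (hs : 0 ≤ s) (ht : 0 ≤ t) :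
    extendedWeight η (s, t) = ENNReal.ofReal (η s t) :=
  Set.indicator_of_mem (Set.mk_mem_prod hs ht) _

theorem lintegral_extendedWeight_le_left {η : ℝ → ℝ → ℝ} {T s : ℝ} (hs : s ∈ Set.Icc 0 T) :
    ∫⁻ t in Set.Icc 0 T, extendedWeight η (s, t) ≤ weightENorm η T := by
  rw [setLIntegral_congr_fun measurableSet_Icc
    fun t ht => extendedWeight_apply (η := η) hs.1 ht.1]
  exact (le_iSup₂ (f := fun s (_ : s ∈ Set.Icc (0 : ℝ) T) =>
    ∫⁻ t in Set.Icc (0 : ℝ) T, ENNReal.ofReal (η s t)) s hs).trans (le_max_right _ _)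

theorem lintegral_extendedWeight_le_right {η : ℝ → ℝ → ℝ} {T t : ℝ} (ht : t ∈ Set.Icc 0 T) :
    ∫⁻ s in Set.Icc 0 T, extendedWeight η (s, t) ≤ weightENorm η T := by
  rw [setLIntegral_congr_fun measurableSet_Icc
    fun s hs => extendedWeight_apply (η := η) hs.1 ht.1]
  exact (le_iSup₂ (f := fun t (_ : t ∈ Set.Icc (0 : ℝ) T) =>
    ∫⁻ s in Set.Icc (0 : ℝ) T, ENNReal.ofReal (η s t)) t ht).trans (le_max_left _ _)

theorem approxLocalTime_eq_toReal (hm₁ : Measurable (Function.uncurry B₁))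
    (hm₂ : Measurable (Function.uncurry B₂)) {η : ℝ → ℝ → ℝ} (hη : IsWeight η) {T : ℝ}
    (hN : weightENorm η T ≠ ∞) {ε : ℝ} (hε : 0 < ε) (ω : Ω) :
    mollifiedTime B₁ B₂ (extendedWeight η) T ε ω ≠ ∞ ∧
      approxLocalTime B₁ B₂ η T ε ω
        = (mollifiedTime B₁ B₂ (extendedWeight η) T ε ω).toReal := by
  set g : ℝ → ℝ → ℝ≥0∞ := fun s t => extendedWeight η (s, t) *
    ENNReal.ofReal (heatKernel ε (B₁ s.toNNReal ω - B₂ t.toNNReal ω)) with hg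
  have hgm : Measurable fun q : ℝ × ℝ => g q.1 q.2 :=
    (measurable_mollifiedTime_integrand hm₁ hm₂ (measurable_extendedWeight hη) ε).comp
      (measurable_const.prodMk measurable_id)
  set C : ℝ≥0∞ := ENNReal.ofReal ((2 * Real.pi * ε) ^ (-(1 / 2 : ℝ))) * weightENorm η T with hC
  have hCtop : C ≠ ∞ := ENNReal.mul_ne_top ENNReal.ofReal_ne_top hN
  have hin : ∀ t ∈ Set.Icc 0 T, ∫⁻ s in Set.Icc 0 T, g s t ≤ C := by
    intro t ht
    calc _ ≤ ∫⁻ s in Set.Icc 0 T, ENNReal.ofReal ((2 * Real.pi * ε) ^ (-(1 / 2 : ℝ))) *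
          extendedWeight η (s, t) := by
          refine lintegral_mono fun s => ?_
          rw [hg, mul_comm]
          exact mul_le_mul_right (ENNReal.ofReal_le_ofReal (heatKernel_le hε _)) _
      _ ≤ C := by
          rw [lintegral_const_mul' _ _ ENNReal.ofReal_ne_top]
          exact mul_le_mul_right (lintegral_extendedWeight_le_right ht) _
  have htot : mollifiedTime B₁ B₂ (extendedWeight η) T ε ω
      = ∫⁻ t in Set.Icc 0 T, ∫⁻ s in Set.Icc 0 T, g s t :=
    lintegral_prod_symm _ hgm.aemeasurable
  refine ⟨?_, ?_⟩
  · rw [htot]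
    refine ne_top_of_le_ne_top ?_ (setLIntegral_mono' measurableSet_Icc hin)
    rw [setLIntegral_const]
    exact ENNReal.mul_ne_top hCtop (by simp)
  · rw [htot, approxLocalTime, ← integral_toReal]
    · refine setIntegral_congr_fun measurableSet_Icc fun t ht => ?_
      rw [← integral_toReal]
      · refine setIntegral_congr_fun measurableSet_Icc fun s hs => ?_
        simp only [hg]
        rw [extendedWeight_apply hs.1 ht.1, ENNReal.toReal_mul,
          ENNReal.toReal_ofReal (hη.nonneg s t hs.1 ht.1),
          ENNReal.toReal_ofReal (heatKernel_nonneg hε _)]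
      · exact (hgm.comp (measurable_id.prodMk measurable_const)).aemeasurable
      · filter_upwards [ae_restrict_mem measurableSet_Icc] with s hs
        simp only [hg]
        rw [extendedWeight_apply hs.1 ht.1]
        exact ENNReal.mul_lt_top ENNReal.ofReal_lt_top ENNReal.ofReal_lt_top
    · exact (Measurable.lintegral_prod_right' (f := fun q : ℝ × ℝ => g q.2 q.1)
        (hgm.comp measurable_swap)).aemeasurable
    · filter_upwards [ae_restrict_mem measurableSet_Icc] with t ht
      exact (hin t ht).trans_lt hCtop.lt_top

theorem Phi_nonneg {x : ℝ} (hx : 0 ≤ x) : 0 ≤ Phi x :=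
  tsum_nonneg fun _ => div_nonneg (by positivity) (Real.Gamma_nonneg_of_nonneg (by positivity))

end WeightedIntersection

open WeightedIntersection in
theorem propositionp2 {Ω : Type*} [MeasurableSpace Ω] (P : Measure Ω) [IsProbabilityMeasure P]
    (B₁ B₂ : ℝ≥0 → Ω → ℝ)
    (hB₁ : IsBrownianReal B₁ P) (hB₂ : IsBrownianReal B₂ P)
    (hindep : IndepFun (fun ω s => B₁ s ω) (fun ω t => B₂ t ω) P)
    (η : ℝ → ℝ → ℝ) (hη : WeightedIntersection.IsWeight η)
    (hC1 : WeightedIntersection.ConditionC1 η)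
    (T : ℝ) (hT : 0 < T) :
    (∀ lam : ℝ, 0 < lam → ∀ ε : ℝ, 0 < ε →
      Integrable
        (fun ω => Real.exp (lam * WeightedIntersection.approxLocalTime B₁ B₂ η T ε ω)) P ∧
      ∫ ω, Real.exp (lam * WeightedIntersection.approxLocalTime B₁ B₂ η T ε ω) ∂P
        ≤ 1 + WeightedIntersection.Phi
            (Real.sqrt T / 2 * WeightedIntersection.weightNorm η T * lam)) ∧
    ∃ I : Ω → ℝ,
      (∀ p : ℝ≥0∞, 1 ≤ p → p ≠ ⊤ →
        (∀ ε : ℝ, 0 < ε → MemLp (WeightedIntersection.approxLocalTime B₁ B₂ η T ε) p P) ∧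
        MemLp I p P ∧
        Tendsto
          (fun ε : ℝ => eLpNorm
            (fun ω => WeightedIntersection.approxLocalTime B₁ B₂ η T ε ω - I ω) p P)
          (𝓝[>] (0 : ℝ)) (𝓝 0)) ∧
      (∀ lam : ℝ, 0 < lam →
        Integrable (fun ω => Real.exp (lam * I ω)) P ∧
        ∫ ω, Real.exp (lam * I ω) ∂P
          ≤ 1 + WeightedIntersection.Phi
              (Real.sqrt T / 2 * WeightedIntersection.weightNorm η T * lam)) := by
  obtain ⟨B₁', hpre₁, hm₁, hae₁⟩ := exists_measurable_modification hB₁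
  obtain ⟨B₂', hpre₂, hm₂, hae₂⟩ := exists_measurable_modification hB₂
  have hindep' : IndepFun (fun ω s => B₁' s ω) (fun ω t => B₂' t ω) P :=
    hindep.congr (hae₁.mono fun ω h => funext h) (hae₂.mono fun ω h => funext h)
  have hN : weightENorm η T ≠ ∞ := (hC1 T hT).ne
  set N := weightENorm η T with hNdef
  have hw := measurable_extendedWeight hη
  set Y : ℝ → Ω → ℝ≥0∞ := mollifiedTime B₁' B₂' (extendedWeight η) T with hYdef
  have hY : ∀ ε, Measurable (Y ε) := measurable_mollifiedTime hm₁ hm₂ hw T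
  have hfin : ∀ ε, 0 < ε → ∀ ω, Y ε ω ≠ ∞ := fun ε hε ω =>
    (approxLocalTime_eq_toReal hm₁ hm₂ hη hN hε ω).1
  have heq : ∀ ε, 0 < ε → approxLocalTime B₁ B₂ η T ε =ᵐ[P] fun ω => (Y ε ω).toReal := by
    intro ε hε
    filter_upwards [hae₁, hae₂] with ω h₁ h₂
    rw [← (approxLocalTime_eq_toReal hm₁ hm₂ hη hN hε ω).2]
    simp only [approxLocalTime, h₁, h₂]
  have hmom : ∀ ε, 0 < ε → ∀ n : ℕ, ∫⁻ ω, Y ε ω ^ n ∂P ≤ n.factorial * momentBound N T n :=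
    fun ε hε n => lintegral_mollifiedTime_pow_le hpre₁ hpre₂ hm₁ hm₂ hindep' hw hT.le
      (fun _ => lintegral_extendedWeight_le_left) (fun _ => lintegral_extendedWeight_le_right) hε n
  have hexp : ∀ lam : ℝ, 0 < lam → ∀ ε : ℝ, 0 < ε →
      ∫⁻ ω, ENNReal.ofReal (Real.exp (lam * (Y ε ω).toReal)) ∂P
        ≤ ENNReal.ofReal (1 + Phi (√T / 2 * weightNorm η T * lam)) := by
    intro lam hlam ε hε
    rw [weightNorm, ← tsum_momentBound hN hT.le hlam.le]
    exact lintegral_exp_le_of_moments (hY ε) (hfin ε hε) (hmom ε hε) hlam.le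
  have hPhi : ∀ lam : ℝ, 0 < lam → 0 ≤ 1 + Phi (√T / 2 * weightNorm η T * lam) := by
    intro lam hlam
    have : 0 ≤ weightNorm η T := ENNReal.toReal_nonneg
    exact add_nonneg zero_le_one (Phi_nonneg (by positivity))
  refine ⟨fun lam hlam ε hε => ?_, ?_⟩
  · have hcongr : (fun ω => Real.exp (lam * approxLocalTime B₁ B₂ η T ε ω))
        =ᵐ[P] fun ω => Real.exp (lam * (Y ε ω).toReal) := by
      filter_upwards [heq ε hε] with ω h
      rw [h]
    rw [integrable_congr hcongr, integral_congr_ae hcongr]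
    exact integrable_and_integral_le_of_lintegral_le
      ((hY ε).ennreal_toReal.const_mul lam).exp.aestronglyMeasurable (fun _ => (Real.exp_pos _).le)
      (hPhi lam hlam) (hexp lam hlam ε hε)
  · obtain ⟨L, hL, hmixed⟩ := exists_tendsto_lintegral_prod_mollifiedTime hpre₁ hpre₂ hm₁ hm₂
      hindep' hw hT.le hN (fun _ => lintegral_extendedWeight_le_left)
      (fun _ => lintegral_extendedWeight_le_right) 2
    have hpos : ∀ᶠ ε in 𝓝[>] (0 : ℝ), 0 < ε := eventually_mem_nhdsWithin
    have hzero : Tendsto (fun ε : ℝ => ε) (𝓝[>] (0 : ℝ)) (𝓝 0) :=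
      tendsto_nhdsWithin_of_tendsto_nhds tendsto_id
    have hmix : Tendsto (fun p : ℝ × ℝ => ∫⁻ ω, Y p.1 ω * Y p.2 ω ∂P)
        (𝓝[>] (0 : ℝ) ×ˢ 𝓝[>] (0 : ℝ)) (𝓝 L) := by
      have h := hmixed (𝓝[>] (0 : ℝ) ×ˢ 𝓝[>] (0 : ℝ)) (fun p => ![p.1, p.2])
        ((hpos.prod_mk hpos).mono fun p hp => by simpa [Fin.forall_fin_two] using hp)
        (Fin.forall_fin_two.2 ⟨hzero.comp tendsto_fst, hzero.comp tendsto_snd⟩)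
      simpa [Fin.prod_univ_two] using h
    obtain ⟨I, hI, e, he, hae⟩ := exists_tendsto_eLpNorm hY hfin
      (fun n => ENNReal.mul_ne_top (by simp) (momentBound_ne_top hN T n)) hmom hL hmix
    refine ⟨I, fun p hp1 hp => ?_, fun lam hlam => ?_⟩
    · obtain ⟨h1, h2, h3⟩ := hI p hp1 hp
      refine ⟨fun ε hε => (memLp_congr_ae (heq ε hε)).2 (h1 ε hε), h2, h3.congr' ?_⟩
      filter_upwards [hpos] with ε hε
      refine eLpNorm_congr_ae ?_
      filter_upwards [heq ε hε] with ω h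
      rw [h]
    · have hIm : AEStronglyMeasurable I P := (hI 1 le_rfl ENNReal.one_ne_top).2.1.1
      refine integrable_and_integral_le_of_lintegral_le
        (hIm.aemeasurable.const_mul lam).exp.aestronglyMeasurable (fun _ => (Real.exp_pos _).le)
        (hPhi lam hlam) ?_
      -- Fatou's lemma along the almost surely convergent sequence.
      calc ∫⁻ ω, ENNReal.ofReal (Real.exp (lam * I ω)) ∂P
          = ∫⁻ ω, liminf (fun k => ENNReal.ofReal (Real.exp (lam * (Y (e k) ω).toReal))) atTop
              ∂P := by
            refine lintegral_congr_ae ?_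
            filter_upwards [hae] with ω h
            have hc : Continuous fun x : ℝ => ENNReal.ofReal (Real.exp (lam * x)) :=
              ENNReal.continuous_ofReal.comp (by fun_prop)
            exact ((hc.tendsto _).comp h).liminf_eq.symm
        _ ≤ liminf (fun k => ∫⁻ ω, ENNReal.ofReal (Real.exp (lam * (Y (e k) ω).toReal)) ∂P)
              atTop := lintegral_liminf_le fun k =>
            ((hY _).ennreal_toReal.const_mul lam).exp.ennreal_ofReal
        _ ≤ _ := by
            refine liminf_le_of_le (by isBoundedDefault) fun b hb => ?_
            obtain ⟨k, hk⟩ := hb.exists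
            exact hk.trans (hexp lam hlam _ (he k))
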